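/- **Setting.** Let $\mathcal X$ be a measurable action space (for instance a compact subset of $\mathbb R^{d_0}$), and let $k_j(x,x')=\phi_j(x)^\top\phi_j(x')\le 1$, $j=1,\dots,p$, be base kernels with measurable feature maps $\phi_j:\mathcal X\to\mathbb R^{d_j}$. Let $\emptyset\ne J^\star\subset\{1,\dots,p\}$ and let $k^\star=\frac1{|J^\star|}\sum_{j\in J^\star}k_j$ be the unknown true kernel. There are $m\ge1$ tasks of $n$ steps each. Task $s$ has the reward $f_s=\sum_{j}\phi_j^\top\beta_s^{\star(j)}$, where $\beta_s^{\star(j)}=0$ for $j\notin J^\star$, and the RKHS norm satisfies $\|f_s\|_{k^\star}\le B$ with $B>0$. Playing $x_{s,i}$ yields $y_{s,i}=f_s(x_{s,i})+\varepsilon_{s,i}$ with independent centred sub-Gaussian noise of variance proxy $\sigma^2$ (that is, $\mathbb E e^{t\varepsilon_{s,i}}\le e^{\sigma^2t^2/2}$ for all $t$). The lifelong regret is $R(m,n)=\sum_{s=1}^m\sum_{i=1}^n\big(\sup f_s-f_s(x_{s,i})\big)$. **LiBO.** In task $s$ the first $\tilde n_s$ actions are exploratory, where $\tilde n_s$ is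 $n_s=\sqrt n/s^{1/4}$ rounded up or down to an integer. The exploratory actions of all tasks are random, with any joint law (for instance i.i.d. uniform), and independent of the noise. Every later action of the task is chosen by the base bandit algorithm BaseBO, an arbitrary (possibly randomised) rule that maps a kernel and the data observed so far in the task (exploratory data included) to an action. BaseBO is supplied with the kernel $\hat k_{s-1}$, where $\hat k_0=\frac1p\sum_{j=1}^pk_j$ and, for $s\ge1$, $\hat k_s=\frac1{|\hat J_s|}\sum_{j\in\hat J_s}k_j$ is the output of Meta-KGL on the exploratory data of the tasks $1,\dots,s$: with $N_s=\sum_{t\le s}\tilde n_t$, $\|b^{(j)}\|_2=(\sum_{t\le s}\|b_t^{(j)}\|_2^2)^{1/2}$, a threshold $0<\omega<c_1$ and $\lambda_s=\min\{\omega,c_1-\omega\}\,c_\kappa^2/(8\sqrt s)$, $$\hat\beta\in\arg\min_b\ \frac1{N_s}\sum_{t\le s}\sum_{i\le\tilde n_t}\Big(y_{t,i}-\sum_j\phi_j(x_{t,i})^\top b_t^{(j)}\Big)^2+\lambda_s\sum_{j=1}^p\|b^{(j)}\|_2,\qquad \hat J_s=\{j:\|\hat\beta^{(j)}\|_2>\omega\sqrt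 s\}.$$ **Assumptions**, for constants $c_1,c_\kappa>0$ and $\delta\in(0,1)$: 1. (Beta-min) $\big(\sum_{t\le s}\|\beta_t^{\star(j)}\|_2^2\big)^{1/2}\ge c_1\sqrt s$ for all $j\in J^\star$ and $s=1,\dots,m$. 2. (Compatibility) With probability at least $1-\delta/4$, for all $s=1,\dots,m$, $$\kappa_s:=\inf_{(J,b)}\ \frac{\sqrt s}{\sqrt{N_s}}\,\frac{\big(\sum_{t\le s}\sum_{i\le\tilde n_t}(\sum_j\phi_j(x_{t,i})^\top b_t^{(j)})^2\big)^{1/2}}{\sum_{j\in J}\|b^{(j)}\|_2}\ \ge\ c_\kappa ,$$ the infimum being over $J\subset\{1,\dots,p\}$ with $|J|\le|J^\star|$ and $b=(b_t^{(j)})_{t\le s,\,j\le p}\ne0$ with $\sum_{j\notin J}\|b^{(j)}\|_2\le3\sum_{j\in J}\|b^{(j)}\|_2$. 3. (Oracle regret) The number $R^\star(m,n)$ bounds the worst-case oracle regret with probability at least $1-\delta/2$: for all $f_1,\dots,f_m$ in the ball of radius $B$ of the RKHS of $k^\star$, if BaseBO is supplied with $k^\star$ in every task (after the same exploratory steps),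 then with probability at least $1-\delta/2$ the regret summed over the steps that BaseBO chooses itself is at most $R^\star(m,n)$. **Theorem.** For all $0<\omega<c_1$, $c_\kappa>0$ and $\sigma\ge0$ there are constants $C,K>0$, depending on $(c_1,c_\kappa,\omega,\sigma)$ only, such that the following holds whenever $n\ge K\sqrt m$. (a) With probability at least $1-\delta$, $$R(m,n)-R^\star(m,n)\ \le\ C\Big(B\,m^{3/4}\sqrt n+B\,(nm)^{1/3}\log^{4/3}(mp/\delta)\Big)+2Bn .$$ If moreover $n\le m^{3/2}$, then with probability at least $1-\delta$ $$R(m,n)-R^\star(m,n)\ \le\ C\Big(B\,m^{3/4}\sqrt n+B\,(nm)^{1/3}\log^{4/3}(mp/\delta)\Big).$$ (b) (The excess is sublinear; LiBO is oracle optimal.) For all $p,B,\delta$ and $\eta>0$ there is $M$ (depending also on $c_1,c_\kappa,\omega,\sigma$) such that for all $m\ge M$ and $n\ge K\sqrt m$, with probability at least $1-\delta$, $R(m,n)-R^\star(m,n)\le\eta\,mn$; and, if moreover $n\le m^{3/2}$, with probability at least $1-\delta$ the average excess per task satisfies $\frac1m\big(R(m,n)-R^\star(m,n)\big)\le\eta\sqrt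 n$. -/

import Mathlib

open MeasureTheory ProbabilityTheory
open scoped NNReal

universe u v w

noncomputable section

namespace LiBO

/-! ### Kernels, features and rewards -/

/-- Coefficients of a single task: one block `β⁽ʲ⁾ ∈ ℝ^{d_j}` for each of the `p` base kernels. -/
abbrev Coeff {p : ℕ} (d : Fin p → ℕ) : Type :=
  (j : Fin p) → EuclideanSpace ℝ (Fin (d j))

/-- Finite-dimensional feature maps `φ_j : 𝒳 → ℝ^{d_j}`, one for each base kernel. -/
abbrev FeatureMaps (𝒳 : Type u) {p : ℕ} (d : Fin p → ℕ) : Type u :=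
  (j : Fin p) → 𝒳 → EuclideanSpace ℝ (Fin (d j))

section Kernels

variable {𝒳 : Type u} {p : ℕ} {d : Fin p → ℕ}

/-- The base kernel `k_j(x, x') = φ_j(x)ᵀ φ_j(x')`. -/
def baseKernel (φ : FeatureMaps 𝒳 d) (j : Fin p) : 𝒳 → 𝒳 → ℝ :=
  fun x x' => inner ℝ (φ j x) (φ j x')

/-- The averaged kernel `(1 / |J|) ∑_{j ∈ J} k_j` (the zero kernel if `J = ∅`). -/
def avgKernel (φ : FeatureMaps 𝒳 d) (J : Finset (Fin p)) : 𝒳 → 𝒳 → ℝ :=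
  fun x x' => (1 / (J.card : ℝ)) * ∑ j ∈ J, baseKernel φ j x x'

/-- The function `x ↦ ∑_j φ_j(x)ᵀ β⁽ʲ⁾`. -/
def linearReward (φ : FeatureMaps 𝒳 d) (b : Coeff d) : 𝒳 → ℝ :=
  fun x => ∑ j, inner ℝ (φ j x) (b j)

/-- `f` belongs to the reproducing kernel Hilbert space of `k` and has RKHS norm at most `B`.
The RKHS of `k` is unique up to an isometry that respects evaluation, so it does not matter which
model `H` of it is used. -/
def InRKHSBall (k : 𝒳 → 𝒳 → ℝ) (B : ℝ) (f : 𝒳 → ℝ) : Prop :=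
  ∃ (H : Type u) (_ : NormedAddCommGroup H) (_ : InnerProductSpace ℝ H) (_ : CompleteSpace H)
    (_ : RKHS ℝ H 𝒳 ℝ),
    (∀ x x', RKHS.kernel H x x' 1 = k x x') ∧ ∃ g : H, (∀ x, g x = f x) ∧ ‖g‖ ≤ B

/-- The instantaneous regret `f(x⋆) - f(x)`, where `f(x⋆) = sup f`. -/
def instRegret (f : 𝒳 → ℝ) (x : 𝒳) : ℝ := (⨆ z, f z) - f x

/-! ### Meta-KGL

Tasks and time steps are numbered from `0`. A data set of the first `s` tasks consists of
`ℓ t` pairs `(x t i, y t i)`, `i < ℓ t`, for every task `t < s`. -/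

/-- The group norm `‖b⁽ʲ⁾‖₂`, where `b⁽ʲ⁾` collects the `j`-th blocks of all `s` tasks. -/
def groupNorm {s : ℕ} (b : Fin s → Coeff d) (j : Fin p) : ℝ :=
  √(∑ t, ‖b t j‖ ^ 2)

/-- The total sample size `N` of the first `s` tasks. -/
def sampleSize (ℓ : ℕ → ℕ) (s : ℕ) : ℕ := ∑ t ∈ Finset.range s, ℓ t

/-- `‖Φ b‖₂` for the block diagonal feature matrix `Φ` of the first `s` tasks. -/
def designNorm (φ : FeatureMaps 𝒳 d) (ℓ : ℕ → ℕ) (x : ℕ → ℕ → 𝒳) {s : ℕ}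
    (b : Fin s → Coeff d) : ℝ :=
  √(∑ t : Fin s, ∑ i ∈ Finset.range (ℓ t), linearReward φ (b t) (x t i) ^ 2)

/-- The compatibility variable `κ(Φ)` of the data of the first `s` tasks at sparsity level `q`. -/
def compatibility (φ : FeatureMaps 𝒳 d) (ℓ : ℕ → ℕ) (x : ℕ → ℕ → 𝒳) (s q : ℕ) : ℝ :=
  sInf {r : ℝ | ∃ (J : Finset (Fin p)) (b : Fin s → Coeff d),
    b ≠ 0 ∧ J.card ≤ q ∧ ∑ j ∈ Jᶜ, groupNorm b j ≤ 3 * ∑ j ∈ J, groupNorm b j ∧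
    r = (√(s : ℝ) / √(sampleSize ℓ s : ℝ)) * (designNorm φ ℓ x b / ∑ j ∈ J, groupNorm b j)}

/-- The group lasso loss `(1/N) ‖y - Φ b‖₂² + lam ∑_j ‖b⁽ʲ⁾‖₂` on the first `s` tasks. -/
def metaLoss (φ : FeatureMaps 𝒳 d) (ℓ : ℕ → ℕ) (x : ℕ → ℕ → 𝒳) (y : ℕ → ℕ → ℝ) (lam : ℝ)
    {s : ℕ} (b : Fin s → Coeff d) : ℝ :=
  (1 / (sampleSize ℓ s : ℝ)) *
      ∑ t : Fin s, ∑ i ∈ Finset.range (ℓ t), (y t i - linearReward φ (b t) (x t i)) ^ 2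
    + lam * ∑ j, groupNorm b j

/-- `J` is an output of Meta-KGL on the data of the first `s` tasks: it is obtained from some
minimiser of the loss by thresholding the group norms at `thr * √s`. -/
def IsMetaKGL (φ : FeatureMaps 𝒳 d) (ℓ : ℕ → ℕ) (x : ℕ → ℕ → 𝒳) (y : ℕ → ℕ → ℝ)
    (lam thr : ℝ) (s : ℕ) (J : Finset (Fin p)) : Prop :=
  ∃ b : Fin s → Coeff d,
    (∀ b' : Fin s → Coeff d, metaLoss φ ℓ x y lam b ≤ metaLoss φ ℓ x y lam b') ∧
    ∀ j, j ∈ J ↔ thr * √(s : ℝ) < groupNorm b j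

/-- The regularisation weight that Meta-KGL uses on `s` tasks:
`min (thr, c₁ - thr) * cκ² / (8 √s)`. -/
def regWeight (c₁ cκ thr : ℝ) (s : ℕ) : ℝ :=
  min thr (c₁ - thr) * cκ ^ 2 / (8 * √(s : ℝ))

end Kernels

/-! ### One bandit task -/

/-- A kernelized bandit algorithm: from a kernel, its internal randomness and the data observed so
far in the current task it computes the next action. -/
abbrev Policy (𝒳 : Type u) (𝒰 : Type w) : Type (max u w) :=
  (𝒳 → 𝒳 → ℝ) → 𝒰 → List (𝒳 × ℝ) → 𝒳

section Task

variable {𝒳 : Type u} {𝒰 : Type w}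

/-- The data `(x_0, y_0), …, (x_{i-1}, y_{i-1})` observed before step `i` of a task with reward `f`
and noise `ε`: the first `ℓ` actions are the forced ones `e`, later ones are chosen by the policy,
supplied with the kernel `k`, on the basis of all the data of the task. -/
def history (π : Policy 𝒳 𝒰) (k : 𝒳 → 𝒳 → ℝ) (r : 𝒰) (f : 𝒳 → ℝ) (ℓ : ℕ) (e : ℕ → 𝒳)
    (ε : ℕ → ℝ) : ℕ → List (𝒳 × ℝ)
  | 0 => []
  | i + 1 =>
      let past := history π k r f ℓ e ε i
      let x := if i < ℓ then e i else π k r past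
      past ++ [(x, f x + ε i)]

/-- The action at step `i` of the task. -/
def action (π : Policy 𝒳 𝒰) (k : 𝒳 → 𝒳 → ℝ) (r : 𝒰) (f : 𝒳 → ℝ) (ℓ : ℕ) (e : ℕ → 𝒳)
    (ε : ℕ → ℝ) (i : ℕ) : 𝒳 :=
  if i < ℓ then e i else π k r (history π k r f ℓ e ε i)

end Task

/-! ### The lifelong problem -/

/-- The data of a run of LiBO on a sequence of bandit tasks. Task `s` here is the
`(s+1)`-st task. -/
structure LifelongBandit (𝒳 : Type u) (Ω : Type v) (𝒰 : Type w) (p : ℕ) where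
  /-- dimensions of the feature maps -/
  d : Fin p → ℕ
  /-- feature maps of the base kernels -/
  φ : FeatureMaps 𝒳 d
  /-- the active kernels -/
  Jstar : Finset (Fin p)
  /-- true coefficients of the rewards -/
  β : ℕ → Coeff d
  /-- `noise s i` is the observation noise at step `i` of task `s` -/
  noise : ℕ → ℕ → Ω → ℝ
  /-- the number of forced exploration steps in task `s` -/
  numExp : ℕ → ℕ
  /-- `explore s i` is the exploratory action at step `i < numExp s` of task `s` -/
  explore : ℕ → ℕ → Ω → 𝒳
  /-- the base bandit algorithm -/
  policy : Policy 𝒳 𝒰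
  /-- internal randomness of the base bandit algorithm in task `s` -/
  seed : ℕ → Ω → 𝒰
  /-- `Jhat s` is the set of kernels selected after the first `s` tasks -/
  Jhat : ℕ → Ω → Finset (Fin p)

namespace LifelongBandit

variable {𝒳 : Type u} {Ω : Type v} {𝒰 : Type w} {p : ℕ}

/-- The true kernel `k⋆`, the average of the active base kernels. -/
def trueKernel (P : LifelongBandit 𝒳 Ω 𝒰 p) : 𝒳 → 𝒳 → ℝ := avgKernel P.φ P.Jstar

/-- The reward function of task `s`. -/
def reward (P : LifelongBandit 𝒳 Ω 𝒰 p) (s : ℕ) : 𝒳 → ℝ := linearReward P.φ (P.β s)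

/-- The observation at the exploratory step `i < numExp s` of task `s`. -/
def expObs (P : LifelongBandit 𝒳 Ω 𝒰 p) (o : Ω) (s i : ℕ) : ℝ :=
  P.reward s (P.explore s i o) + P.noise s i o

/-- The kernel that LiBO hands to the base algorithm for task `s`: the average of all base kernels
for the first task, and afterwards the kernel learned from the `s` previous tasks. -/
def liboKernel (P : LifelongBandit 𝒳 Ω 𝒰 p) (o : Ω) (s : ℕ) : 𝒳 → 𝒳 → ℝ :=
  if s = 0 then avgKernel P.φ Finset.univ else avgKernel P.φ (P.Jhat s o)

/-- The action at step `i` of task `s`, if the task has reward `f` and the base algorithm is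
supplied with the kernel `k`. -/
def act (P : LifelongBandit 𝒳 Ω 𝒰 p) (o : Ω) (k : 𝒳 → 𝒳 → ℝ) (f : 𝒳 → ℝ) (s i : ℕ) : 𝒳 :=
  action P.policy k (P.seed s o) f (P.numExp s) (fun i => P.explore s i o)
    (fun i => P.noise s i o) i

/-- The lifelong regret `R(m, n)` of LiBO. -/
def liboRegret (P : LifelongBandit 𝒳 Ω 𝒰 p) (m n : ℕ) (o : Ω) : ℝ :=
  ∑ s ∈ Finset.range m, ∑ i ∈ Finset.range n,
    instRegret (P.reward s) (P.act o (P.liboKernel o s) (P.reward s) s i)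

/-- The regret that the base algorithm incurs on its own steps (those that are not forced) in `m`
tasks with rewards `f 0, …, f (m-1)`, if it is supplied with the true kernel in every task. -/
def oracleRegret (P : LifelongBandit 𝒳 Ω 𝒰 p) (f : ℕ → 𝒳 → ℝ) (m n : ℕ) (o : Ω) : ℝ :=
  ∑ s ∈ Finset.range m, ∑ i ∈ Finset.Ico (P.numExp s) n,
    instRegret (f s) (P.act o P.trueKernel (f s) s i)

/-- The number `Rstar` bounds the worst-case oracle regret with probability at least `1 - δ`:
it does so for all rewards in the ball of radius `B` in the RKHS of the true kernel. -/
def HasOracleRegret [MeasurableSpace Ω] (P : LifelongBandit 𝒳 Ω 𝒰 p) (μ : Measure Ω) (m n : ℕ)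
    (B δ Rstar : ℝ) : Prop :=
  ∀ f : ℕ → 𝒳 → ℝ, (∀ s < m, InRKHSBall P.trueKernel B (f s)) →
    μ {o | Rstar < P.oracleRegret f m n o} ≤ ENNReal.ofReal δ

/-- The setting: `P` is a run of LiBO with threshold `thr` on `m` tasks of length `n`. -/
structure IsLiBO [MeasurableSpace 𝒳] [MeasurableSpace Ω] (P : LifelongBandit 𝒳 Ω 𝒰 p)
    (μ : Measure Ω) (m n : ℕ) (c₁ cκ thr B δ : ℝ) (σ : ℝ≥0) : Prop where
  /-- the base kernels are normalised -/
  kernel_le_one : ∀ j x x', baseKernel P.φ j x x' ≤ 1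
  measurable_feature : ∀ j, Measurable (P.φ j)
  Jstar_nonempty : P.Jstar.Nonempty
  /-- only active kernels contribute to the rewards -/
  support : ∀ s < m, ∀ j, j ∉ P.Jstar → P.β s j = 0
  /-- the rewards have RKHS norm at most `B` -/
  norm_le : ∀ s < m, InRKHSBall P.trueKernel B (P.reward s)
  /-- beta-min condition for the first `s` tasks -/
  betaMin : ∀ s, 1 ≤ s → s ≤ m → ∀ j ∈ P.Jstar,
    c₁ * √(s : ℝ) ≤ groupNorm (fun t : Fin s => P.β t) j
  /-- with probability at least `1 - δ/4` the exploratory data of the first `s` tasks is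
  sufficiently informative, for all `s` -/
  informative : μ {o | ∃ s, 1 ≤ s ∧ s ≤ m ∧
      compatibility P.φ P.numExp (fun t i => P.explore t i o) s P.Jstar.card < cκ}
    ≤ ENNReal.ofReal (δ / 4)
  measurable_noise : ∀ s i, Measurable (P.noise s i)
  noise_indep : iIndepFun (fun (q : ℕ × ℕ) (o : Ω) => P.noise q.1 q.2 o) μ
  /-- the noise is (centred) sub-Gaussian with variance proxy `σ²` -/
  noise_subgaussian : ∀ s i, HasSubgaussianMGF (P.noise s i) (σ ^ 2) μ
  measurable_explore : ∀ s i, Measurable (P.explore s i)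
  /-- the exploratory actions are drawn from an arbitrary joint law, independently of the noise -/
  explore_indep : IndepFun (fun (o : Ω) (q : ℕ × ℕ) => P.explore q.1 q.2 o)
    (fun (o : Ω) (q : ℕ × ℕ) => P.noise q.1 q.2 o) μ
  /-- there are `√n / (s+1)^{1/4}` exploratory steps, rounded up or down, in the `(s+1)`-st task -/
  floor_le_numExp : ∀ s < m, ⌊√(n : ℝ) / ((s : ℝ) + 1) ^ (1 / 4 : ℝ)⌋₊ ≤ P.numExp s
  numExp_le_ceil : ∀ s < m, P.numExp s ≤ ⌈√(n : ℝ) / ((s : ℝ) + 1) ^ (1 / 4 : ℝ)⌉₊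
  /-- the kernel is meta-learned by Meta-KGL from the exploratory data of the first `s` tasks -/
  metaKGL : ∀ s, 1 ≤ s → s ≤ m → ∀ o,
    IsMetaKGL P.φ P.numExp (fun t i => P.explore t i o) (P.expObs o)
      (regWeight c₁ cκ thr s) thr s (P.Jhat s o)

end LifelongBandit

/-- The excess regret rate `B m^{3/4} √n + B (nm)^{1/3} log(mp/δ)^{4/3}`. -/
def excessRate (B δ : ℝ) (p m n : ℕ) : ℝ :=
  B * (m : ℝ) ^ (3 / 4 : ℝ) * √(n : ℝ) +
    B * ((n : ℝ) * m) ^ (1 / 3 : ℝ) * Real.log ((m : ℝ) * p / δ) ^ (4 / 3 : ℝ)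

end LiBO

end

namespace LiBO

/-! ### Exponential moments of squared norms of sub-Gaussian sums -/

section ExpMoments

variable {E : Type*} [NormedAddCommGroup E] [InnerProductSpace ℝ E] [FiniteDimensional ℝ E]
  [MeasurableSpace E] [BorelSpace E]

/-! Once Meta-KGL has found exactly the active set, LiBO and the oracle coincide: an action is a
function of kernel, seed, reward, forced actions and noise, and all of these agree. So the excess
has three sources: the forced steps, at regret at most `2 * B` each; the early tasks, before
recovery is certain; and the first task, played with the average of all base kernels. The last two
cost at most `2 * B * n` per task. The exploration lengths sum to order `m^{3/4} √n`.

Recovery (`IsMetaKGL.eq_of_noiseEnergy_le`) is the deterministic group lasso argument. If the noise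
is weakly correlated with every feature block, the basic inequality puts the error in the cone of
the compatibility condition, which bounds its group norms by a fraction of `min thr (c₁ - thr) *
√s`. Thresholding then separates active from inactive kernels.

The probabilistic core is the tail of `noiseEnergy`, the squared dual norm of the noise on one
feature block. Writing `exp (θ ‖v‖²)` as a Gaussian average of exponentials of linear forms, and
then applying Jensen, gives an exponential moment that does not see the feature dimension. Moments
multiply over tasks, and independence of design and noise allows the design to be frozen. With `θ`
of order `1 / √n` the failure probability is `exp (-c √n √s)`; `n ≥ K √m` makes the threshold
dominate the mean (`chernoff_exponent_le`).

A union bound leaves as early only tasks with `c √(n s) < L`, where `L = log (4mp/δ)`. Their number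
`k` satisfies `k ≤ m` and `n k ≲ L²`; interpolating `n k = (n k)^{1/3} (n k)^{2/3}` gives the second
term of the rate (`mul_card_earlyTasks_le`). -/

lemma map_inner_stdGaussian (z : E) :
    (stdGaussian E).map (fun g => inner ℝ z g) = gaussianReal 0 (‖z‖₊ ^ 2) := by
  have h := IsGaussian.map_eq_gaussianReal (μ := stdGaussian E) (innerSL ℝ z)
  rw [integral_strongDual_stdGaussian, variance_dual_stdGaussian, innerSL_apply_norm] at h
  have h2 : (‖z‖ ^ 2).toNNReal = ‖z‖₊ ^ 2 := by
    rw [Real.toNNReal_pow (norm_nonneg z), norm_toNNReal]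
  rw [h2] at h
  exact h

/-- Used from right to left: it trades the exponential of a squared norm for exponentials of linear
forms, to which sub-Gaussianity applies. -/
lemma lintegral_exp_inner_stdGaussian (z : E) :
    ∫⁻ g, ENNReal.ofReal (Real.exp (inner ℝ z g)) ∂(stdGaussian E)
      = ENNReal.ofReal (Real.exp (‖z‖ ^ 2 / 2)) := by
  have h1 : ∫⁻ g, ENNReal.ofReal (Real.exp (inner ℝ z g)) ∂(stdGaussian E)
      = ∫⁻ x, ENNReal.ofReal (Real.exp x) ∂(gaussianReal 0 (‖z‖₊ ^ 2)) := by
    rw [← map_inner_stdGaussian z, lintegral_map (by fun_prop) (by fun_prop)]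
  rw [h1, ← ofReal_integral_eq_lintegral_ofReal]
  · have h2 := congrFun (mgf_fun_id_gaussianReal (μ := 0) (v := ‖z‖₊ ^ 2)) 1
    simp only [mgf, one_mul, mul_one, one_pow, zero_add] at h2
    rw [h2]
    simp
  · simpa using integrable_exp_mul_gaussianReal (μ := 0) (v := ‖z‖₊ ^ 2) 1
  · exact Filter.Eventually.of_forall fun x => (Real.exp_pos x).le

/-- The integral equals `(1 - 2b)^{-1/2}`, and `(1 - 2b)(1 + 4b) ≥ 1` holds exactly because `b ≤
1/4`. -/
lemma lintegral_exp_sq_gaussianReal_le {b : ℝ} (hb : 0 ≤ b) (hb' : b ≤ 1 / 4) :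
    ∫⁻ x, ENNReal.ofReal (Real.exp (b * x ^ 2)) ∂(gaussianReal 0 1)
      ≤ ENNReal.ofReal (Real.exp (2 * b)) := by
  have h1 : ∫⁻ x, ENNReal.ofReal (Real.exp (b * x ^ 2)) ∂(gaussianReal 0 1)
      = ∫⁻ x : ℝ, ENNReal.ofReal ((√(2 * Real.pi))⁻¹ * Real.exp (-(1 / 2 - b) * x ^ 2)) := by
    rw [gaussianReal_of_var_ne_zero _ one_ne_zero,
      lintegral_withDensity_eq_lintegral_mul _ (measurable_gaussianPDF _ _) (by fun_prop)]
    refine lintegral_congr fun x => ?_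
    rw [Pi.mul_apply, gaussianPDF, ← ENNReal.ofReal_mul (gaussianPDFReal_nonneg _ _ _),
      gaussianPDFReal]
    simp only [NNReal.coe_one, mul_one, sub_zero]
    rw [mul_assoc, ← Real.exp_add]
    congr 3
    ring
  have hi : Integrable fun x : ℝ => (√(2 * Real.pi))⁻¹ * Real.exp (-(1 / 2 - b) * x ^ 2) :=
    (integrable_exp_neg_mul_sq (by linarith)).const_mul _
  rw [h1, ← ofReal_integral_eq_lintegral_ofReal hi
    (Filter.Eventually.of_forall fun x => by positivity), integral_const_mul, integral_gaussian]
  apply ENNReal.ofReal_le_ofReal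
  have hpi := Real.pi_pos
  have h3 : (√(2 * Real.pi))⁻¹ * √(Real.pi / (1 / 2 - b)) = √((1 - 2 * b)⁻¹) := by
    rw [← Real.sqrt_inv, ← Real.sqrt_mul (by positivity)]
    congr 1
    have : (1 / 2 - b) ≠ 0 := by linarith
    have : (1 - 2 * b) ≠ 0 := by linarith
    field_simp
  rw [h3]
  apply Real.sqrt_le_iff.2 ⟨(Real.exp_pos _).le, ?_⟩
  rw [← Real.exp_nat_mul]
  have h4 : 1 + 4 * b ≤ Real.exp ((2 : ℕ) * (2 * b)) := by
    have := Real.add_one_le_exp ((2 : ℕ) * (2 * b))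
    push_cast at this ⊢
    linarith
  refine le_trans ?_ h4
  rw [inv_le_iff_one_le_mul₀ (by linarith)]
  nlinarith

lemma lintegral_exp_sq_inner_stdGaussian_le {z : E} (hz : ‖z‖ ≤ 1) {b : ℝ} (hb : 0 ≤ b)
    (hb' : b ≤ 1 / 4) :
    ∫⁻ g, ENNReal.ofReal (Real.exp (b * (inner ℝ z g) ^ 2)) ∂(stdGaussian E)
      ≤ ENNReal.ofReal (Real.exp (2 * b)) := by
  have h0 : (gaussianReal 0 1).map (fun x => ‖z‖ * x) = gaussianReal 0 (‖z‖₊ ^ 2) := by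
    rw [gaussianReal_map_const_mul]
    congr 1
    · simp
    · ext; simp
  have h1 : ∫⁻ g, ENNReal.ofReal (Real.exp (b * (inner ℝ z g) ^ 2)) ∂(stdGaussian E)
      = ∫⁻ x, ENNReal.ofReal (Real.exp (b * (‖z‖ * x) ^ 2)) ∂(gaussianReal 0 1) := by
    rw [← lintegral_map (f := fun y => ENNReal.ofReal (Real.exp (b * y ^ 2)))
      (g := fun g => inner ℝ z g) (by fun_prop) (by fun_prop), map_inner_stdGaussian, ← h0,
      lintegral_map (by fun_prop) (by fun_prop)]
  rw [h1]
  refine le_trans (lintegral_mono fun x => ?_) (lintegral_exp_sq_gaussianReal_le hb hb')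
  apply ENNReal.ofReal_le_ofReal
  rw [Real.exp_le_exp, mul_pow]
  have : ‖z‖ ^ 2 ≤ 1 := pow_le_one₀ (norm_nonneg z) hz
  have : ‖z‖ ^ 2 * x ^ 2 ≤ x ^ 2 := by nlinarith [sq_nonneg x]
  exact mul_le_mul_of_nonneg_left this hb

variable {Ω : Type*} [MeasurableSpace Ω] {μ : Measure Ω} [IsProbabilityMeasure μ]

/-- Exponential moments of the squared norm of a sum of independent sub-Gaussian multiples of
vectors of norm at most one. -/
lemma lintegral_exp_norm_sq_sum_le {ι : Type*} {X : ι → Ω → ℝ} (hm : ∀ i, Measurable (X i))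
    (hind : iIndepFun X μ) {c : ℝ≥0} (hX : ∀ i, HasSubgaussianMGF (X i) c μ) (S : Finset ι)
    {u : ι → E} (hu : ∀ i, ‖u i‖ ≤ 1) {θ : ℝ} (hθ : 0 ≤ θ) (hθ' : 4 * θ * c * S.card ≤ 1) :
    ∫⁻ o, ENNReal.ofReal (Real.exp (θ * ‖∑ i ∈ S, X i o • u i‖ ^ 2)) ∂μ
      ≤ ENNReal.ofReal (Real.exp (2 * θ * c * S.card)) := by
  rcases S.eq_empty_or_nonempty with rfl | hS
  · simp
  have hq : (0 : ℝ) < S.card := by exact_mod_cast hS.card_pos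
  -- Linearise with an auxiliary Gaussian `g`; after exchanging the integrals, `g` is fixed and the
  -- exponent is a sum of independent sub-Gaussian variables.
  have h1 : ∀ o, ENNReal.ofReal (Real.exp (θ * ‖∑ i ∈ S, X i o • u i‖ ^ 2))
      = ∫⁻ g, ENNReal.ofReal (Real.exp (∑ i ∈ S, √(2 * θ) * inner ℝ (u i) g * X i o))
        ∂(stdGaussian E) := by
    intro o
    have h := lintegral_exp_inner_stdGaussian (√(2 * θ) • ∑ i ∈ S, X i o • u i)
    rw [norm_smul, mul_pow, Real.norm_eq_abs, sq_abs, Real.sq_sqrt (by positivity)] at h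
    rw [show 2 * θ * ‖∑ i ∈ S, X i o • u i‖ ^ 2 / 2 = θ * ‖∑ i ∈ S, X i o • u i‖ ^ 2 by ring] at h
    rw [← h]
    refine lintegral_congr fun g => ?_
    congr 2
    rw [real_inner_smul_left, sum_inner, Finset.mul_sum]
    refine Finset.sum_congr rfl fun i _ => ?_
    rw [real_inner_smul_left]
    ring
  simp_rw [h1]
  rw [lintegral_lintegral_swap (by fun_prop)]
  have h2 : ∀ g : E, ∫⁻ o, ENNReal.ofReal
        (Real.exp (∑ i ∈ S, √(2 * θ) * inner ℝ (u i) g * X i o)) ∂μ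
      ≤ ∑ i ∈ S, ENNReal.ofReal ((S.card : ℝ)⁻¹) *
        ENNReal.ofReal (Real.exp (θ * c * S.card * (inner ℝ (u i) g) ^ 2)) := by
    intro g
    have hsub := HasSubgaussianMGF.sum_of_iIndepFun (s := S)
      (hind.comp (fun i x => √(2 * θ) * inner ℝ (u i) g * x) (fun i => by fun_prop))
      (fun i _ => (hX i).const_mul (√(2 * θ) * inner ℝ (u i) g))
    have hint := hsub.integrable_exp_mul 1
    have hle := hsub.mgf_le 1
    simp only [mgf, one_mul, one_pow, mul_one, Function.comp_apply] at hint hle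
    rw [← ofReal_integral_eq_lintegral_ofReal hint
      (Filter.Eventually.of_forall fun o => (Real.exp_pos _).le)]
    simp_rw [← ENNReal.ofReal_mul (inv_nonneg.2 hq.le)]
    rw [← ENNReal.ofReal_sum_of_nonneg (fun i _ => by positivity)]
    apply ENNReal.ofReal_le_ofReal
    refine hle.trans ?_
    -- Jensen with uniform weights leaves one scalar `inner ℝ (u i) g` at a time, so no covariance
    -- matrix and no dimension enters.
    have hj := convexOn_exp.map_sum_le (t := S) (w := fun _ => (S.card : ℝ)⁻¹)
      (p := fun i => θ * c * S.card * (inner ℝ (u i) g) ^ 2) (fun i _ => by positivity)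
      (by rw [Finset.sum_const, nsmul_eq_mul, mul_inv_cancel₀ hq.ne']) (fun i _ => Set.mem_univ _)
    simp only [smul_eq_mul] at hj
    refine le_trans (le_of_eq ?_) hj
    congr 1
    push_cast
    rw [Finset.sum_div]
    refine Finset.sum_congr rfl fun i _ => ?_
    change (√(2 * θ) * inner ℝ (u i) g) ^ 2 * (c : ℝ) / 2 = _
    rw [mul_pow, Real.sq_sqrt (by positivity)]
    field_simp
  refine (lintegral_mono h2).trans ?_
  rw [lintegral_finsetSum _ (fun i _ => by fun_prop)]
  have h3 : ∀ i ∈ S, ∫⁻ g, ENNReal.ofReal ((S.card : ℝ)⁻¹) *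
        ENNReal.ofReal (Real.exp (θ * c * S.card * (inner ℝ (u i) g) ^ 2)) ∂(stdGaussian E)
      ≤ ENNReal.ofReal ((S.card : ℝ)⁻¹) * ENNReal.ofReal (Real.exp (2 * θ * c * S.card)) := by
    intro i _
    rw [lintegral_const_mul _ (by fun_prop)]
    gcongr
    refine (lintegral_exp_sq_inner_stdGaussian_le (hu i) (by positivity) (by linarith)).trans ?_
    rw [show 2 * (θ * c * S.card) = 2 * θ * c * S.card by ring]
  refine (Finset.sum_le_sum h3).trans (le_of_eq ?_)
  rw [Finset.sum_const, nsmul_eq_mul, ← mul_assoc, ← ENNReal.ofReal_natCast,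
    ← ENNReal.ofReal_mul hq.le, mul_inv_cancel₀ hq.ne', ENNReal.ofReal_one, one_mul]

/-- The sum over the tasks of the squared norms of the noise-weighted feature sums. -/
def noiseEnergy (ℓ : ℕ → ℕ) (s : ℕ) (u : ℕ × ℕ → E) (y : ℕ × ℕ → ℝ) : ℝ :=
  ∑ t ∈ Finset.range s, ‖∑ i ∈ Finset.range (ℓ t), y (t, i) • u (t, i)‖ ^ 2

lemma measurable_noiseEnergy {α : Type*} [MeasurableSpace α] (ℓ : ℕ → ℕ) (s : ℕ)
    {f : α → ℕ × ℕ → E} {g : α → ℕ × ℕ → ℝ} (hf : ∀ q, Measurable fun a => f a q)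
    (hg : ∀ q, Measurable fun a => g a q) :
    Measurable fun a => noiseEnergy ℓ s (f a) (g a) := by
  unfold noiseEnergy
  fun_prop

/-- Different tasks use disjoint blocks of the noise, so the moments factor; hence the restriction
on `θ` involves the length of a single task and not the total sample size. -/
lemma lintegral_exp_noiseEnergy_le {X : ℕ × ℕ → Ω → ℝ} (hm : ∀ q, Measurable (X q))
    (hind : iIndepFun X μ) {c : ℝ≥0} (hX : ∀ q, HasSubgaussianMGF (X q) c μ)
    {u : ℕ × ℕ → E} (hu : ∀ q, ‖u q‖ ≤ 1) (ℓ : ℕ → ℕ) {θ : ℝ} (hθ : 0 ≤ θ) (s : ℕ)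
    (hθ' : ∀ t < s, 4 * θ * c * ℓ t ≤ 1) :
    ∫⁻ o, ENNReal.ofReal (Real.exp (θ * noiseEnergy ℓ s u (fun q => X q o))) ∂μ
      ≤ ENNReal.ofReal (Real.exp (2 * θ * c * sampleSize ℓ s)) := by
  induction s with
  | zero => simp [noiseEnergy, sampleSize]
  | succ s ih =>
    obtain ⟨S, hS⟩ : ∃ S : Finset (ℕ × ℕ), ∀ q, q ∈ S ↔ q.1 < s ∧ q.2 < ℓ q.1 :=
      ⟨((Finset.range s).sigma fun t => Finset.range (ℓ t)).image fun q => (q.1, q.2), by simp⟩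
    obtain ⟨T, hT⟩ : ∃ T : Finset (ℕ × ℕ), ∀ q, q ∈ T ↔ q.1 = s ∧ q.2 < ℓ s :=
      ⟨(Finset.range (ℓ s)).image fun i => (s, i), by simp [Prod.ext_iff, and_comm, eq_comm]⟩
    have hST : Disjoint S T := by
      rw [Finset.disjoint_left]
      intro q h1 h2
      have h1 := (hS q).1 h1
      have h2 := (hT q).1 h2
      omega
    have hI := hind.indepFun_finset S T hST hm
    -- Extension by zero outside the block turns both factors into functions of the finitely many
    -- variables in `S` and `T`, as block independence requires.
    let A : (S → ℝ) → ENNReal := fun z => ENNReal.ofReal (Real.exp (θ *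
      noiseEnergy ℓ s u (fun q => if h : q ∈ S then z ⟨q, h⟩ else 0)))
    let B : (T → ℝ) → ENNReal := fun z => ENNReal.ofReal (Real.exp (θ *
      ‖∑ i ∈ Finset.range (ℓ s), (if h : (s, i) ∈ T then z ⟨(s, i), h⟩ else 0) • u (s, i)‖ ^ 2))
    have hA : Measurable A := by
      have hz : ∀ q : ℕ × ℕ, Measurable fun z : S → ℝ => if h : q ∈ S then z ⟨q, h⟩ else 0 := by
        intro q
        by_cases h : q ∈ S
        · simp only [h, dite_true]; fun_prop
        · simp only [h, dite_false]; fun_prop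
      have h2 := measurable_noiseEnergy ℓ s (f := fun _ => u) (fun q => measurable_const) hz
      exact (h2.const_mul θ).exp.ennreal_ofReal
    have hB : Measurable B := by
      have : ∀ i, Measurable fun z : T → ℝ => if h : (s, i) ∈ T then z ⟨(s, i), h⟩ else 0 := by
        intro i
        by_cases h : (s, i) ∈ T
        · simp only [h, dite_true]; fun_prop
        · simp only [h, dite_false]; fun_prop
      fun_prop
    have hA' : ∀ o, A (fun q => X q o)
        = ENNReal.ofReal (Real.exp (θ * noiseEnergy ℓ s u (fun q => X q o))) := by
      intro o
      simp only [A, noiseEnergy]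
      congr 3
      refine Finset.sum_congr rfl fun t ht => ?_
      congr 2
      refine Finset.sum_congr rfl fun i hi => ?_
      have : (t, i) ∈ S := (hS _).2 ⟨Finset.mem_range.1 ht, Finset.mem_range.1 hi⟩
      rw [dif_pos this]
    have hB' : ∀ o, B (fun q => X q o) = ENNReal.ofReal (Real.exp (θ *
        ‖∑ i ∈ Finset.range (ℓ s), X (s, i) o • u (s, i)‖ ^ 2)) := by
      intro o
      simp only [B]
      congr 5
      refine Finset.sum_congr rfl fun i hi => ?_
      have : (s, i) ∈ T := (hT _).2 ⟨rfl, Finset.mem_range.1 hi⟩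
      rw [dif_pos this]
    have hAB := hI.comp hA hB
    have hsplit : ∀ o, ENNReal.ofReal (Real.exp (θ * noiseEnergy ℓ (s + 1) u (fun q => X q o)))
        = ENNReal.ofReal (Real.exp (θ * noiseEnergy ℓ s u (fun q => X q o))) *
          ENNReal.ofReal (Real.exp (θ *
            ‖∑ i ∈ Finset.range (ℓ s), X (s, i) o • u (s, i)‖ ^ 2)) := by
      intro o
      rw [← ENNReal.ofReal_mul (Real.exp_pos _).le, ← Real.exp_add, ← mul_add, noiseEnergy,
        Finset.sum_range_succ, noiseEnergy]
    simp_rw [hsplit, ← hA', ← hB']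
    have hmS : Measurable fun o => (fun q : S => X q o) := by fun_prop
    have hmT : Measurable fun o => (fun q : T => X q o) := by fun_prop
    have hmul := lintegral_mul_eq_lintegral_mul_lintegral_of_indepFun
      (hA.comp hmS) (hB.comp hmT) hAB
    refine hmul.le.trans ?_
    have e1 : ∫⁻ o, (A ∘ fun o => (fun q : S => X q o)) o ∂μ
        ≤ ENNReal.ofReal (Real.exp (2 * θ * c * sampleSize ℓ s)) := by
      simp only [Function.comp_def, hA']
      exact ih fun t ht => hθ' t (by omega)
    have e2 : ∫⁻ o, (B ∘ fun o => (fun q : T => X q o)) o ∂μ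
        ≤ ENNReal.ofReal (Real.exp (2 * θ * c * ℓ s)) := by
      simp only [Function.comp_def, hB']
      have hinj : Function.Injective fun i : ℕ => (s, i) := fun a b h => by simpa using h
      have := lintegral_exp_norm_sq_sum_le (fun i => hm (s, i)) (hind.precomp hinj)
        (fun i => hX (s, i)) (Finset.range (ℓ s)) (fun i => hu (s, i)) hθ
        (by simpa using hθ' s (by omega))
      simpa using this
    refine (mul_le_mul' e1 e2).trans (le_of_eq ?_)
    rw [← ENNReal.ofReal_mul (Real.exp_pos _).le, ← Real.exp_add]
    congr 2
    rw [sampleSize, sampleSize, Finset.sum_range_succ]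
    push_cast
    ring

lemma measure_noiseEnergy_ge_le {X : ℕ × ℕ → Ω → ℝ} (hm : ∀ q, Measurable (X q))
    (hind : iIndepFun X μ) {c : ℝ≥0} (hX : ∀ q, HasSubgaussianMGF (X q) c μ)
    {u : ℕ × ℕ → E} (hu : ∀ q, ‖u q‖ ≤ 1) (ℓ : ℕ → ℕ) {θ : ℝ} (hθ : 0 ≤ θ) (s : ℕ)
    (hθ' : ∀ t < s, 4 * θ * c * ℓ t ≤ 1) (τ : ℝ) :
    μ {o | τ ≤ noiseEnergy ℓ s u (fun q => X q o)}
      ≤ ENNReal.ofReal (Real.exp (2 * θ * c * sampleSize ℓ s - θ * τ)) := by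
  have h1 := lintegral_exp_noiseEnergy_le hm hind hX hu ℓ hθ s hθ'
  have hmeas : Measurable fun o => noiseEnergy ℓ s u (fun q => X q o) :=
    measurable_noiseEnergy ℓ s (fun q => measurable_const) hm
  have h2 := mul_meas_ge_le_lintegral (μ := μ)
    (f := fun o => ENNReal.ofReal (Real.exp (θ * noiseEnergy ℓ s u (fun q => X q o))))
    (by fun_prop) (ENNReal.ofReal (Real.exp (θ * τ)))
  have h3 : μ {o | τ ≤ noiseEnergy ℓ s u (fun q => X q o)} ≤
      μ {o | ENNReal.ofReal (Real.exp (θ * τ)) ≤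
        ENNReal.ofReal (Real.exp (θ * noiseEnergy ℓ s u (fun q => X q o)))} := by
    refine measure_mono fun o ho => ?_
    rw [Set.mem_ofPred_eq] at ho ⊢
    gcongr
  refine h3.trans ?_
  rw [Real.exp_sub, ENNReal.ofReal_div_of_pos (Real.exp_pos _)]
  rw [ENNReal.le_div_iff_mul_le (Or.inl (by simp [Real.exp_pos])) (Or.inl ENNReal.ofReal_ne_top),
    mul_comm]
  exact h2.trans h1

/-- The tail bound for the noise energy of a random design that is independent of the noise. -/
lemma measure_noiseEnergy_random_ge_le {𝒴 : Type*} [MeasurableSpace 𝒴]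
    {X : ℕ × ℕ → Ω → ℝ} (hm : ∀ q, Measurable (X q))
    (hind : iIndepFun X μ) {c : ℝ≥0} (hX : ∀ q, HasSubgaussianMGF (X q) c μ)
    {Z : ℕ × ℕ → Ω → 𝒴} (hZ : ∀ q, Measurable (Z q))
    (hZX : IndepFun (fun o q => Z q o) (fun o q => X q o) μ)
    {u : 𝒴 → E} (hum : Measurable u) (hu : ∀ q, ‖u q‖ ≤ 1) (ℓ : ℕ → ℕ) {θ : ℝ} (hθ : 0 ≤ θ)
    (s : ℕ) (hθ' : ∀ t < s, 4 * θ * c * ℓ t ≤ 1) (τ : ℝ) :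
    μ {o | τ ≤ noiseEnergy ℓ s (fun q => u (Z q o)) (fun q => X q o)}
      ≤ ENNReal.ofReal (Real.exp (2 * θ * c * sampleSize ℓ s - θ * τ)) := by
  have hmX : Measurable fun o => (fun q => X q o) := measurable_pi_lambda _ hm
  have hmZ : Measurable fun o => (fun q => Z q o) := measurable_pi_lambda _ hZ
  let D : Set ((ℕ × ℕ → 𝒴) × (ℕ × ℕ → ℝ)) :=
    {q | τ ≤ noiseEnergy ℓ s (fun r => u (q.1 r)) q.2}
  have hD : MeasurableSet D := by
    refine measurableSet_le measurable_const ?_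
    exact measurable_noiseEnergy ℓ s (fun q => by fun_prop) (fun q => by fun_prop)
  have h1 : μ {o | τ ≤ noiseEnergy ℓ s (fun q => u (Z q o)) (fun q => X q o)}
      = (μ.map fun o => ((fun q => Z q o), (fun q => X q o))) D := by
    rw [Measure.map_apply (hmZ.prodMk hmX) hD]
    rfl
  have := Measure.isProbabilityMeasure_map (μ := μ) hmX.aemeasurable
  have := Measure.isProbabilityMeasure_map (μ := μ) hmZ.aemeasurable
  -- By independence the joint law is a product; the fixed-design bound is uniform in the design and
  -- can be integrated.
  rw [h1, hZX.map_prod_eq_prod_map_map hmZ.aemeasurable hmX.aemeasurable,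
    Measure.prod_apply hD]
  have h2 : ∀ z : ℕ × ℕ → 𝒴, (μ.map fun o => (fun q => X q o)) (Prod.mk z ⁻¹' D)
      ≤ ENNReal.ofReal (Real.exp (2 * θ * c * sampleSize ℓ s - θ * τ)) := by
    intro z
    rw [Measure.map_apply hmX (measurable_prodMk_left hD)]
    exact measure_noiseEnergy_ge_le hm hind hX (fun q => hu (z q)) ℓ hθ s hθ' τ
  refine (lintegral_mono h2).trans ?_
  simp

end ExpMoments


/-! ### Support recovery by Meta-KGL -/

section SupportRecovery

variable {𝒳 : Type u} {p : ℕ} {d : Fin p → ℕ}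

lemma groupNorm_nonneg {s : ℕ} (b : Fin s → Coeff d) (j : Fin p) : 0 ≤ groupNorm b j :=
  Real.sqrt_nonneg _

lemma groupNorm_eq_norm {s : ℕ} (b : Fin s → Coeff d) (j : Fin p) :
    groupNorm b j = ‖WithLp.toLp 2 fun t => b t j‖ := by
  rw [PiLp.norm_eq_of_L2]
  rfl

lemma groupNorm_le_add_sub {s : ℕ} (a b : Fin s → Coeff d) (j : Fin p) :
    groupNorm a j ≤ groupNorm b j + groupNorm (a - b) j := by
  rw [groupNorm_eq_norm, groupNorm_eq_norm, groupNorm_eq_norm]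
  refine le_trans (le_of_eq ?_) (norm_add_le _ _)
  congr 1
  ext t : 1
  simp

lemma groupNorm_sub_comm {s : ℕ} (a b : Fin s → Coeff d) (j : Fin p) :
    groupNorm (a - b) j = groupNorm (b - a) j := by
  unfold groupNorm
  congr 1
  refine Finset.sum_congr rfl fun t _ => ?_
  rw [Pi.sub_apply, Pi.sub_apply, Pi.sub_apply, Pi.sub_apply, norm_sub_rev]

lemma groupNorm_eq_zero_of_forall {s : ℕ} {b : Fin s → Coeff d} {j : Fin p}
    (h : ∀ t, b t j = 0) : groupNorm b j = 0 := by
  simp [groupNorm, h]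

lemma eq_zero_of_groupNorm_eq_zero {s : ℕ} {b : Fin s → Coeff d}
    (h : ∀ j, groupNorm b j = 0) : b = 0 := by
  funext t j
  have h1 := h j
  rw [groupNorm, Real.sqrt_eq_zero (Finset.sum_nonneg fun _ _ => by positivity),
    Finset.sum_eq_zero_iff_of_nonneg (fun _ _ => by positivity)] at h1
  simpa using h1 t (Finset.mem_univ t)

lemma linearReward_sub (φ : FeatureMaps 𝒳 d) (a b : Coeff d) (x : 𝒳) :
    linearReward φ (a - b) x = linearReward φ a x - linearReward φ b x := by
  simp [linearReward, inner_sub_right]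

/-- The empirical correlation of the noise with a linear predictor is bounded blockwise. -/
lemma sum_noise_mul_linearReward_le (φ : FeatureMaps 𝒳 d) (ℓ : ℕ → ℕ) (x : ℕ → ℕ → 𝒳)
    (ε : ℕ → ℕ → ℝ) {s : ℕ} (b : Fin s → Coeff d) :
    ∑ t : Fin s, ∑ i ∈ Finset.range (ℓ t), ε t i * linearReward φ (b t) (x t i)
      ≤ ∑ j, √(noiseEnergy ℓ s (fun q => φ j (x q.1 q.2)) (fun q => ε q.1 q.2)) *
        groupNorm b j := by
  have h1 : ∑ t : Fin s, ∑ i ∈ Finset.range (ℓ t), ε t i * linearReward φ (b t) (x t i)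
      = ∑ j, ∑ t : Fin s, inner ℝ (∑ i ∈ Finset.range (ℓ t), ε t i • φ j (x t i)) (b t j) := by
    rw [Finset.sum_comm]
    refine Finset.sum_congr rfl fun t _ => ?_
    simp_rw [sum_inner, linearReward, Finset.mul_sum, real_inner_smul_left]
    rw [Finset.sum_comm]
  rw [h1]
  refine Finset.sum_le_sum fun j _ => ?_
  calc ∑ t : Fin s, inner ℝ (∑ i ∈ Finset.range (ℓ t), ε t i • φ j (x t i)) (b t j)
      ≤ ∑ t : Fin s, ‖∑ i ∈ Finset.range (ℓ t), ε t i • φ j (x t i)‖ * ‖b t j‖ :=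
        Finset.sum_le_sum fun t _ => real_inner_le_norm _ _
    _ ≤ _ := by
        refine (Real.sum_mul_le_sqrt_mul_sqrt _ _ _).trans (le_of_eq ?_)
        rw [noiseEnergy, Finset.sum_range, groupNorm]

/-- The basic inequality for minimisers of the Meta-KGL loss. -/
lemma metaLoss_basic_inequality {φ : FeatureMaps 𝒳 d} {ℓ : ℕ → ℕ} {x : ℕ → ℕ → 𝒳}
    {ε y : ℕ → ℕ → ℝ} {lam : ℝ} {s : ℕ} {a b : Fin s → Coeff d}
    (hy : ∀ t : Fin s, ∀ i, y t i = linearReward φ (b t) (x t i) + ε t i)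
    (hN : 0 < sampleSize ℓ s) (hlam : 0 ≤ lam)
    (hmin : metaLoss φ ℓ x y lam a ≤ metaLoss φ ℓ x y lam b)
    (hnoise : ∀ j, 16 * noiseEnergy ℓ s (fun q => φ j (x q.1 q.2)) (fun q => ε q.1 q.2)
      ≤ (sampleSize ℓ s * lam) ^ 2) :
    designNorm φ ℓ x (a - b) ^ 2 / sampleSize ℓ s + lam * ∑ j, groupNorm a j
      ≤ lam / 2 * ∑ j, groupNorm (a - b) j + lam * ∑ j, groupNorm b j := by
  have hN' : (0 : ℝ) < sampleSize ℓ s := by exact_mod_cast hN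
  -- The factor `1/4` makes the doubled cross term cost only `lam / 2` times the group norms, half
  -- of the penalty.
  have hsq : ∀ j, √(noiseEnergy ℓ s (fun q => φ j (x q.1 q.2)) (fun q => ε q.1 q.2))
      ≤ sampleSize ℓ s * lam / 4 := by
    intro j
    refine Real.sqrt_le_iff.2 ⟨by positivity, ?_⟩
    have := hnoise j
    nlinarith
  have hcross : ∑ t : Fin s, ∑ i ∈ Finset.range (ℓ t),
      ε t i * linearReward φ ((a - b) t) (x t i)
      ≤ sampleSize ℓ s * lam / 4 * ∑ j, groupNorm (a - b) j := by
    refine (sum_noise_mul_linearReward_le φ ℓ x ε (a - b)).trans ?_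
    rw [Finset.mul_sum]
    exact Finset.sum_le_sum fun j _ => mul_le_mul_of_nonneg_right (hsq j) (groupNorm_nonneg _ _)
  have hdes : designNorm φ ℓ x (a - b) ^ 2
      = ∑ t : Fin s, ∑ i ∈ Finset.range (ℓ t), linearReward φ ((a - b) t) (x t i) ^ 2 :=
    Real.sq_sqrt (Finset.sum_nonneg fun _ _ => Finset.sum_nonneg fun _ _ => sq_nonneg _)
  have hexp : ∑ t : Fin s, ∑ i ∈ Finset.range (ℓ t), (y t i - linearReward φ (a t) (x t i)) ^ 2
      = ∑ t : Fin s, ∑ i ∈ Finset.range (ℓ t), (y t i - linearReward φ (b t) (x t i)) ^ 2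
        - 2 * (∑ t : Fin s, ∑ i ∈ Finset.range (ℓ t),
            ε t i * linearReward φ ((a - b) t) (x t i))
        + designNorm φ ℓ x (a - b) ^ 2 := by
    rw [hdes, Finset.mul_sum, ← Finset.sum_sub_distrib, ← Finset.sum_add_distrib]
    refine Finset.sum_congr rfl fun t _ => ?_
    rw [Finset.mul_sum, ← Finset.sum_sub_distrib, ← Finset.sum_add_distrib]
    refine Finset.sum_congr rfl fun i _ => ?_
    rw [hy, Pi.sub_apply, linearReward_sub]
    ring
  unfold metaLoss at hmin
  rw [hexp] at hmin
  set Q := ∑ t : Fin s, ∑ i ∈ Finset.range (ℓ t), (y t i - linearReward φ (b t) (x t i)) ^ 2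
  set R := ∑ t : Fin s, ∑ i ∈ Finset.range (ℓ t), ε t i * linearReward φ ((a - b) t) (x t i)
  have h3 : 1 / (sampleSize ℓ s : ℝ) * (Q - 2 * R + designNorm φ ℓ x (a - b) ^ 2)
      = 1 / (sampleSize ℓ s : ℝ) * Q - 2 * (R / sampleSize ℓ s)
        + designNorm φ ℓ x (a - b) ^ 2 / sampleSize ℓ s := by ring
  have h4 : R / sampleSize ℓ s ≤ lam / 4 * ∑ j, groupNorm (a - b) j := by
    rw [div_le_iff₀ hN']
    linarith
  linarith

/-- The estimation error of the group lasso. -/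
lemma sum_groupNorm_sub_le {φ : FeatureMaps 𝒳 d} {ℓ : ℕ → ℕ} {x : ℕ → ℕ → 𝒳}
    {lam c : ℝ} {s : ℕ} {a b : Fin s → Coeff d} {J : Finset (Fin p)} (hs : 0 < s)
    (hN : 0 < sampleSize ℓ s) (hlam : 0 < lam) (hc : 0 < c)
    (hcomp : c ≤ compatibility φ ℓ x s J.card)
    (hb : ∀ t, ∀ j ∉ J, b t j = 0)
    (hbasic : designNorm φ ℓ x (a - b) ^ 2 / sampleSize ℓ s + lam * ∑ j, groupNorm a j
      ≤ lam / 2 * ∑ j, groupNorm (a - b) j + lam * ∑ j, groupNorm b j) :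
    ∑ j, groupNorm (a - b) j ≤ 2 * lam * s / c ^ 2 := by
  have hs' : (0 : ℝ) < s := by exact_mod_cast hs
  have hN' : (0 : ℝ) < sampleSize ℓ s := by exact_mod_cast hN
  set D := designNorm φ ℓ x (a - b) with hD
  have hD0 : 0 ≤ D := Real.sqrt_nonneg _
  set U := ∑ j ∈ J, groupNorm (a - b) j with hU
  set V := ∑ j ∈ Jᶜ, groupNorm (a - b) j with hV
  have hU0 : 0 ≤ U := Finset.sum_nonneg fun _ _ => groupNorm_nonneg _ _
  have hV0 : 0 ≤ V := Finset.sum_nonneg fun _ _ => groupNorm_nonneg _ _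
  have hUV : ∑ j, groupNorm (a - b) j = U + V := (Finset.sum_add_sum_compl J _).symm
  have hdiff : ∑ j, groupNorm b j ≤ ∑ j, groupNorm a j + U - V := by
    rw [← Finset.sum_add_sum_compl J (groupNorm b), ← Finset.sum_add_sum_compl J (groupNorm a)]
    have h1 : ∑ j ∈ J, groupNorm b j ≤ ∑ j ∈ J, groupNorm a j + U := by
      rw [hU, ← Finset.sum_add_distrib]
      refine Finset.sum_le_sum fun j _ => ?_
      rw [groupNorm_sub_comm]
      exact groupNorm_le_add_sub b a j
    have h2 : ∑ j ∈ Jᶜ, groupNorm b j = 0 :=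
      Finset.sum_eq_zero fun j hj =>
        groupNorm_eq_zero_of_forall fun t => hb t j (Finset.mem_compl.1 hj)
    have h3 : V = ∑ j ∈ Jᶜ, groupNorm a j := by
      refine Finset.sum_congr rfl fun j hj => ?_
      unfold groupNorm
      congr 1
      refine Finset.sum_congr rfl fun t _ => ?_
      rw [Pi.sub_apply, Pi.sub_apply, hb t j (Finset.mem_compl.1 hj), sub_zero]
    linarith
  have hmain : D ^ 2 / sampleSize ℓ s + lam / 2 * V ≤ 3 / 2 * lam * U := by
    rw [hUV] at hbasic
    nlinarith
  have hcone : V ≤ 3 * U := by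
    have : 0 ≤ D ^ 2 / sampleSize ℓ s := by positivity
    nlinarith
  rw [hUV]
  -- The infimum defining the compatibility runs over nonzero vectors only; for those the cone
  -- condition forces `U > 0`.
  by_cases hzero : a - b = 0
  · have : ∀ j, groupNorm (a - b) j = 0 := fun j => by
      rw [hzero]; exact groupNorm_eq_zero_of_forall fun t => rfl
    have h1 : U = 0 := Finset.sum_eq_zero fun j _ => this j
    have h2 : V = 0 := Finset.sum_eq_zero fun j _ => this j
    rw [h1, h2, add_zero]
    positivity
  have hUpos : 0 < U := by
    rcases hU0.lt_or_eq with h | h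
    · exact h
    · exfalso
      apply hzero
      apply eq_zero_of_groupNorm_eq_zero
      have h1 : ∑ j, groupNorm (a - b) j = 0 := by rw [hUV]; linarith
      rw [Finset.sum_eq_zero_iff_of_nonneg (fun _ _ => groupNorm_nonneg _ _)] at h1
      exact fun j => h1 j (Finset.mem_univ j)
  have hle : c ≤ (√(s : ℝ) / √(sampleSize ℓ s : ℝ)) * (D / U) := by
    refine hcomp.trans (csInf_le ⟨0, ?_⟩ ⟨J, a - b, hzero, le_rfl, hcone, rfl⟩)
    rintro r ⟨J', b', -, -, -, rfl⟩
    have h1 : 0 ≤ ∑ j ∈ J', groupNorm b' j := Finset.sum_nonneg fun _ _ => groupNorm_nonneg _ _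
    have h2 : 0 ≤ designNorm φ ℓ x b' := Real.sqrt_nonneg _
    positivity
  have hsq : c ^ 2 * U ^ 2 ≤ s * (D ^ 2 / sampleSize ℓ s) := by
    have h1 : c * U ≤ √(s : ℝ) / √(sampleSize ℓ s : ℝ) * D := by
      rw [← mul_div_assoc, le_div_iff₀ hUpos] at hle
      exact hle
    have h2 := pow_le_pow_left₀ (by positivity) h1 2
    rw [mul_pow, mul_pow, div_pow, Real.sq_sqrt hs'.le, Real.sq_sqrt hN'.le] at h2
    refine h2.trans (le_of_eq (by ring))
  rw [le_div_iff₀ (by positivity)]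
  have h5 : s * (D ^ 2 / sampleSize ℓ s) ≤ s * (3 / 2 * lam * U - lam / 2 * V) :=
    mul_le_mul_of_nonneg_left (by linarith) hs'.le
  -- Multiply the quadratic bound on `U` by `c ^ 2` and use `c⁴U² ≥ 2c²U·(lam s) - (lam s)²`; this
  -- leaves half of `U` to join `V / 2` on the left.
  have h6 : lam * s * ((U + V) * c ^ 2) ≤ lam * s * (2 * lam * s) := by
    nlinarith [sq_nonneg (c ^ 2 * U - lam * s), mul_le_mul_of_nonneg_left (hsq.trans h5) (sq_nonneg c)]
  exact le_of_mul_le_mul_left h6 (by positivity)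

/-- Meta-KGL selects exactly the active kernels, if the noise is weakly correlated with the
features and the data are informative. -/
theorem IsMetaKGL.eq_of_noiseEnergy_le {φ : FeatureMaps 𝒳 d} {ℓ : ℕ → ℕ} {x : ℕ → ℕ → 𝒳}
    {ε y : ℕ → ℕ → ℝ} {c₁ cκ thr : ℝ} {s : ℕ} {β : ℕ → Coeff d} {J Jstar : Finset (Fin p)}
    (hthr : 0 < thr) (hthr' : thr < c₁) (hcκ : 0 < cκ) (hs : 0 < s) (hN : 0 < sampleSize ℓ s)
    (hJ : IsMetaKGL φ ℓ x y (regWeight c₁ cκ thr s) thr s J)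
    (hy : ∀ t < s, ∀ i, y t i = linearReward φ (β t) (x t i) + ε t i)
    (hsupp : ∀ t < s, ∀ j ∉ Jstar, β t j = 0)
    (hbeta : ∀ j ∈ Jstar, c₁ * √(s : ℝ) ≤ groupNorm (fun t : Fin s => β t) j)
    (hcomp : cκ ≤ compatibility φ ℓ x s Jstar.card)
    (hnoise : ∀ j, 16 * noiseEnergy ℓ s (fun q => φ j (x q.1 q.2)) (fun q => ε q.1 q.2)
      ≤ (sampleSize ℓ s * regWeight c₁ cκ thr s) ^ 2) :
    J = Jstar := by
  obtain ⟨a, hmin, hsel⟩ := hJ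
  set b : Fin s → Coeff d := fun t => β t with hb
  have hs' : (0 : ℝ) < s := by exact_mod_cast hs
  have hgap : 0 < min thr (c₁ - thr) := lt_min hthr (by linarith)
  have hlam : 0 < regWeight c₁ cκ thr s := by unfold regWeight; positivity
  have herr := sum_groupNorm_sub_le hs hN hlam hcκ hcomp (a := a) (b := b)
    (fun t j hj => hsupp t t.2 j hj)
    (metaLoss_basic_inequality (fun t i => hy t t.2 i) hN hlam.le (hmin b) hnoise)
  -- The weight is tuned so that the total error is a quarter of the margin; any error below the
  -- margin separates the two groups.
  have hval : 2 * regWeight c₁ cκ thr s * s / cκ ^ 2 = min thr (c₁ - thr) / 4 * √(s : ℝ) := by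
    unfold regWeight
    have h1 : √(s : ℝ) ≠ 0 := (Real.sqrt_pos.2 hs').ne'
    have h2 : (s : ℝ) = √(s : ℝ) * √(s : ℝ) := (Real.mul_self_sqrt hs'.le).symm
    rw [div_eq_iff (by positivity)]
    field_simp
    rw [Real.sq_sqrt hs'.le]
    ring
  have hj : ∀ j, groupNorm (a - b) j < min thr (c₁ - thr) * √(s : ℝ) := by
    intro j
    have h1 : groupNorm (a - b) j ≤ ∑ j, groupNorm (a - b) j :=
      Finset.single_le_sum (f := fun j => groupNorm (a - b) j)
        (fun _ _ => groupNorm_nonneg _ _) (Finset.mem_univ j)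
    have h2 : 0 < min thr (c₁ - thr) * √(s : ℝ) := mul_pos hgap (Real.sqrt_pos.2 hs')
    rw [hval] at herr
    linarith
  have hsqrt := Real.sqrt_nonneg (s : ℝ)
  ext j
  rw [hsel j]
  constructor
  · intro h
    by_contra hjn
    have h1 : groupNorm b j = 0 := groupNorm_eq_zero_of_forall fun t => hsupp t t.2 j hjn
    have h2 := groupNorm_le_add_sub a b j
    have h3 := mul_le_mul_of_nonneg_right (min_le_left thr (c₁ - thr)) hsqrt
    linarith [hj j]
  · intro h
    have h1 := hbeta j h
    have h2 := groupNorm_le_add_sub b a j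
    rw [groupNorm_sub_comm] at h2
    have h3 := mul_le_mul_of_nonneg_right (min_le_right thr (c₁ - thr)) hsqrt
    linarith [hj j]

end SupportRecovery

/-! ### Functions in an RKHS ball -/

section RKHSBall

variable {𝒳 : Type u}

/-- The reproducing property gives `|g x| ≤ ‖g‖ √(k x x)`. This is what bounds the regret of a
single step by `2 * B`. -/
lemma InRKHSBall.abs_le {k : 𝒳 → 𝒳 → ℝ} {B : ℝ} {f : 𝒳 → ℝ} (h : InRKHSBall k B f)
    (hk : ∀ x, |k x x| ≤ 1) (x : 𝒳) : |f x| ≤ B := by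
  obtain ⟨H, _, _, _, _, hker, g, hg, hgB⟩ := h
  have h1 := RKHS.norm_apply_le g x
  have h2 : ‖RKHS.kernel H x x‖ ≤ 1 := by
    refine ContinuousLinearMap.opNorm_le_bound _ zero_le_one fun r => ?_
    have : RKHS.kernel H x x r = r * k x x := by
      rw [← hker x x, ← smul_eq_mul, ← map_smul, smul_eq_mul, mul_one]
    rw [this, norm_mul, mul_comm]
    exact mul_le_mul_of_nonneg_right (hk x) (norm_nonneg r)
  rw [hg, Real.norm_eq_abs] at h1
  have h3 : √‖RKHS.kernel H x x‖ ≤ 1 := Real.sqrt_le_one.2 h2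
  nlinarith [norm_nonneg g]

variable {p : ℕ} {d : Fin p → ℕ}

lemma abs_avgKernel_self_le_one {φ : FeatureMaps 𝒳 d} (hφ : ∀ j x x', baseKernel φ j x x' ≤ 1)
    (J : Finset (Fin p)) (x : 𝒳) : |avgKernel φ J x x| ≤ 1 := by
  have h0 : ∀ j, 0 ≤ baseKernel φ j x x := fun j => real_inner_self_nonneg
  have h1 : 0 ≤ ∑ j ∈ J, baseKernel φ j x x := Finset.sum_nonneg fun j _ => h0 j
  have h2 : ∑ j ∈ J, baseKernel φ j x x ≤ J.card := by
    refine (Finset.sum_le_sum fun j _ => hφ j x x).trans ?_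
    simp
  rw [avgKernel, abs_of_nonneg (by positivity), one_div_mul_eq_div]
  exact div_le_one_of_le₀ h2 (by positivity)

lemma norm_feature_le_one {φ : FeatureMaps 𝒳 d} (hφ : ∀ j x x', baseKernel φ j x x' ≤ 1)
    (j : Fin p) (x : 𝒳) : ‖φ j x‖ ≤ 1 := by
  have h := hφ j x x
  rw [baseKernel, real_inner_self_eq_norm_sq] at h
  exact (sq_le_one_iff₀ (norm_nonneg _)).1 h

lemma instRegret_nonneg {f : 𝒳 → ℝ} {B : ℝ} (hf : ∀ x, |f x| ≤ B) (x : 𝒳) :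
    0 ≤ instRegret f x :=
  sub_nonneg.2 (le_ciSup (f := f) ⟨B, by rintro _ ⟨z, rfl⟩; exact (abs_le.1 (hf z)).2⟩ x)

lemma instRegret_le {f : 𝒳 → ℝ} {B : ℝ} (hf : ∀ x, |f x| ≤ B) (x : 𝒳) :
    instRegret f x ≤ 2 * B := by
  have : Nonempty 𝒳 := ⟨x⟩
  have h1 : ⨆ z, f z ≤ B := ciSup_le fun z => (abs_le.1 (hf z)).2
  have h2 := (abs_le.1 (hf x)).1
  unfold instRegret
  linarith

end RKHSBall


/-! ### The numbers of exploration steps -/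

section SampleSizes

lemma rpow_quarter_eq_sqrt_sqrt {x : ℝ} (hx : 0 ≤ x) : x ^ (1 / 4 : ℝ) = √√x := by
  rw [Real.sqrt_eq_rpow, Real.sqrt_eq_rpow, ← Real.rpow_mul hx]
  norm_num

lemma sqrt_sqrt_pow_four {x : ℝ} (hx : 0 ≤ x) : √√x ^ 4 = x := by
  rw [show √√x ^ 4 = (√√x ^ 2) ^ 2 by ring, Real.sq_sqrt (Real.sqrt_nonneg _), Real.sq_sqrt hx]

lemma rpow_three_quarters_eq_sqrt_sqrt {x : ℝ} (hx : 0 ≤ x) : x ^ (3 / 4 : ℝ) = √√x ^ 3 := by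
  rw [← rpow_quarter_eq_sqrt_sqrt hx, ← Real.rpow_natCast, ← Real.rpow_mul hx]
  norm_num

/-- Telescoping: with `a⁴ = m + 1` and `b⁴ = m`, the inequality `4b³a ≤ 3b⁴ + a⁴` gives `a (a³ - b³)
≥ 3/4`, hence `1 / a ≤ 2 (a³ - b³)`. -/
lemma sum_inv_sqrt_sqrt_le (m : ℕ) :
    ∑ s ∈ Finset.range m, 1 / √√((s : ℝ) + 1) ≤ 2 * √√(m : ℝ) ^ 3 := by
  induction m with
  | zero => simp
  | succ m ih =>
    rw [Finset.sum_range_succ]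
    have h1 : √√((m : ℝ) + 1) ^ 4 = m + 1 := sqrt_sqrt_pow_four (by positivity)
    have h2 : √√(m : ℝ) ^ 4 = m := sqrt_sqrt_pow_four (by positivity)
    have ha : 0 < √√((m : ℝ) + 1) := by positivity
    have hb : 0 ≤ √√(m : ℝ) := Real.sqrt_nonneg _
    push_cast
    set a := √√((m : ℝ) + 1)
    set b := √√(m : ℝ)
    have hab : 4 * (b ^ 3 * a) ≤ 3 * b ^ 4 + a ^ 4 := by
      nlinarith [mul_nonneg (sq_nonneg (a - b)) (sq_nonneg (a + b)), sq_nonneg (a - b),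
        mul_nonneg (sq_nonneg (a - b)) (sq_nonneg b), mul_nonneg ha.le hb]
    have h3 : 1 / a ≤ 2 * (a ^ 3 - b ^ 3) := by
      rw [div_le_iff₀ ha]
      nlinarith
    linarith

variable {m n : ℕ} {K : ℝ} {ℓ : ℕ → ℕ}

lemma mul_sqrt_sqrt_le_sqrt (hK : 0 ≤ K) (hn : K * √(m : ℝ) ≤ n) {s : ℕ} (hs : s ≤ m) :
    √K * √√(s : ℝ) ≤ √(n : ℝ) := by
  rw [← Real.sqrt_mul hK]
  apply Real.sqrt_le_sqrt
  refine le_trans ?_ hn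
  gcongr

/-- Since the unrounded length is at least one, rounding up or down changes it by at most a factor
of two. -/
lemma one_le_numExp_bound (hK : 1 ≤ K) (hn : K * √(m : ℝ) ≤ n) {s : ℕ} (hs : s < m) :
    1 ≤ √(n : ℝ) / ((s : ℝ) + 1) ^ (1 / 4 : ℝ) := by
  rw [rpow_quarter_eq_sqrt_sqrt (by positivity), le_div_iff₀ (by positivity), one_mul]
  have h1 := mul_sqrt_sqrt_le_sqrt (zero_le_one.trans hK) hn (s := s + 1) hs
  have h2 : 1 ≤ √K := Real.one_le_sqrt.2 hK
  push_cast at h1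
  have h3 := Real.sqrt_nonneg (√((s : ℝ) + 1))
  nlinarith

lemma numExp_le_two_mul (hK : 1 ≤ K) (hn : K * √(m : ℝ) ≤ n) {s : ℕ} (hs : s < m)
    (hc : ℓ s ≤ ⌈√(n : ℝ) / ((s : ℝ) + 1) ^ (1 / 4 : ℝ)⌉₊) :
    (ℓ s : ℝ) ≤ 2 * (√(n : ℝ) * (1 / √√((s : ℝ) + 1))) := by
  have h1 := one_le_numExp_bound hK hn hs
  have h2 : (ℓ s : ℝ) ≤ (⌈√(n : ℝ) / ((s : ℝ) + 1) ^ (1 / 4 : ℝ)⌉₊ : ℝ) := by exact_mod_cast hc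
  have h3 := Nat.ceil_lt_add_one (zero_le_one.trans h1)
  rw [← rpow_quarter_eq_sqrt_sqrt (by positivity), mul_one_div]
  linarith

lemma half_le_numExp (hK : 1 ≤ K) (hn : K * √(m : ℝ) ≤ n) {s : ℕ} (hs : s < m)
    (hf : ⌊√(n : ℝ) / ((s : ℝ) + 1) ^ (1 / 4 : ℝ)⌋₊ ≤ ℓ s) :
    √(n : ℝ) / √√((s : ℝ) + 1) / 2 ≤ ℓ s := by
  have h1 := one_le_numExp_bound hK hn hs
  have h2 : (⌊√(n : ℝ) / ((s : ℝ) + 1) ^ (1 / 4 : ℝ)⌋₊ : ℝ) ≤ (ℓ s : ℝ) := by exact_mod_cast hf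
  have h3 := Nat.lt_floor_add_one (√(n : ℝ) / ((s : ℝ) + 1) ^ (1 / 4 : ℝ))
  have h4 : (1 : ℝ) ≤ (⌊√(n : ℝ) / ((s : ℝ) + 1) ^ (1 / 4 : ℝ)⌋₊ : ℝ) := by
    exact_mod_cast Nat.one_le_floor_iff _ |>.2 h1
  rw [← rpow_quarter_eq_sqrt_sqrt (by positivity)]
  linarith

lemma le_sampleSize (hK : 1 ≤ K) (hn : K * √(m : ℝ) ≤ n)
    (hf : ∀ t < m, ⌊√(n : ℝ) / ((t : ℝ) + 1) ^ (1 / 4 : ℝ)⌋₊ ≤ ℓ t) {s : ℕ} (hs : s ≤ m) :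
    √(n : ℝ) * √√(s : ℝ) ^ 3 / 2 ≤ sampleSize ℓ s := by
  rcases Nat.eq_zero_or_pos s with rfl | hs0
  · simp
  have hs1 : (0 : ℝ) < s := by exact_mod_cast hs0
  have hq : 0 < √√(s : ℝ) := by positivity
  have h1 : ∀ t ∈ Finset.range s, √(n : ℝ) / √√(s : ℝ) / 2 ≤ (ℓ t : ℝ) := by
    intro t ht
    have ht := Finset.mem_range.1 ht
    refine le_trans ?_ (half_le_numExp hK hn (ht.trans_le hs) (hf t (ht.trans_le hs)))
    have : (t : ℝ) + 1 ≤ s := by exact_mod_cast ht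
    gcongr
  have h2 := Finset.card_nsmul_le_sum _ _ _ h1
  rw [Finset.card_range, nsmul_eq_mul] at h2
  rw [sampleSize]
  push_cast
  refine le_trans (le_of_eq ?_) h2
  have h4 : (s : ℝ) = √√(s : ℝ) ^ 4 := (sqrt_sqrt_pow_four hs1.le).symm
  set q := √√(s : ℝ)
  rw [h4]
  field_simp

end SampleSizes

/-! ### The Chernoff exponent -/

/-- Here `r = √n`, `q = s^{1/4}`, `N` is the sample size and `a / q ^ 2` the lasso weight. The
hypotheses give `N a² ≥ 64 v q⁴`, so the mean term uses at most half of the threshold term; the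
other half is bounded through `N² ≥ r² q⁶ / 4`. -/
lemma chernoff_exponent_le {v a κ r q N : ℝ} (hv : 0 < v) (ha : 0 < a) (hκ : 128 * v / a ^ 2 ≤ κ)
    (hr : 0 < r) (hq : 0 < q) (hrq : κ * q ≤ r) (hN : r * q ^ 3 / 2 ≤ N) :
    2 * (1 / (8 * v * r)) * v * N - 1 / (8 * v * r) * ((N * (a / q ^ 2)) ^ 2 / 16)
      ≤ -(a ^ 2 / (1024 * v) * (r * q ^ 2)) := by
  have hN0 : 0 < N := lt_of_lt_of_le (by positivity) hN
  have h1 : 64 * v * q ^ 4 ≤ N * a ^ 2 := by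
    rw [div_le_iff₀ (by positivity)] at hκ
    have h2 : κ * q * q ^ 3 / 2 ≤ N := le_trans (by gcongr) hN
    nlinarith [mul_le_mul_of_nonneg_right hκ (by positivity : 0 ≤ q ^ 4 / 2),
      mul_le_mul_of_nonneg_right h2 (sq_nonneg a)]
  have h2 : r ^ 2 * q ^ 6 / 4 ≤ N ^ 2 := by
    have := pow_le_pow_left₀ (by positivity) hN 2
    nlinarith
  have h3 : 2 * (1 / (8 * v * r)) * v * N - 1 / (8 * v * r) * ((N * (a / q ^ 2)) ^ 2 / 16)
      = -((N ^ 2 * a ^ 2 - 32 * v * N * q ^ 4) / (128 * v * r * q ^ 4)) := by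
    field_simp
    ring
  have h4 : a ^ 2 / (1024 * v) * (r * q ^ 2)
      = (r ^ 2 * q ^ 6 / 4 * (a ^ 2 / 2)) / (128 * v * r * q ^ 4) := by
    field_simp
    norm_num
  rw [h3, h4, neg_le_neg_iff]
  gcongr
  nlinarith [mul_le_mul_of_nonneg_right h2 (by positivity : 0 ≤ a ^ 2 / 2),
    mul_le_mul_of_nonneg_left h1 hN0.le]

/-- A sub-Gaussian random variable is sub-Gaussian for every larger variance proxy. -/
lemma _root_.ProbabilityTheory.HasSubgaussianMGF.mono_param {Ω : Type*} [MeasurableSpace Ω]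
    {μ : Measure Ω} {X : Ω → ℝ} {c c' : ℝ≥0} (h : HasSubgaussianMGF X c μ) (hc : c ≤ c') :
    HasSubgaussianMGF X c' μ :=
  ⟨h.integrable_exp_mul, fun t => (h.mgf_le t).trans (by gcongr)⟩

/-! ### The failure probability of Meta-KGL -/

namespace LifelongBandit

variable {𝒳 : Type u} {Ω : Type v} {𝒰 : Type w} {p : ℕ} [MeasurableSpace 𝒳] [MeasurableSpace Ω]
  {P : LifelongBandit 𝒳 Ω 𝒰 p} {μ : Measure Ω} {m n : ℕ} {c₁ cκ thr B δ : ℝ} {σ : ℝ≥0}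

/-- The noise energy of the `j`-th features in the exploratory data of the first `s` tasks. -/
noncomputable def exploreEnergy (P : LifelongBandit 𝒳 Ω 𝒰 p) (s : ℕ) (j : Fin p) (o : Ω) : ℝ :=
  noiseEnergy P.numExp s (fun q => P.φ j (P.explore q.1 q.2 o)) (fun q => P.noise q.1 q.2 o)

/-- The constant in the exponent of the failure probability of Meta-KGL. -/
noncomputable def tailRate (c₁ cκ thr : ℝ) (σ : ℝ≥0) : ℝ :=
  (min thr (c₁ - thr) * cκ ^ 2 / 8) ^ 2 / (1024 * (σ ^ 2 + 1))

/-- The factor in the lower bound on the length of the tasks. -/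
noncomputable def horizonFactor (c₁ cκ thr : ℝ) (σ : ℝ≥0) : ℝ :=
  max 1 ((128 * (σ ^ 2 + 1) / (min thr (c₁ - thr) * cκ ^ 2 / 8) ^ 2) ^ 2)

lemma one_le_horizonFactor : 1 ≤ horizonFactor c₁ cκ thr σ := le_max_left _ _

lemma tailRate_pos (hthr : 0 < thr) (hthr' : thr < c₁) (hcκ : 0 < cκ) :
    0 < tailRate c₁ cκ thr σ := by
  have : 0 < min thr (c₁ - thr) := lt_min hthr (by linarith)
  unfold tailRate
  positivity

lemma IsLiBO.measure_exploreEnergy_ge_le [IsProbabilityMeasure μ]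
    (h : P.IsLiBO μ m n c₁ cκ thr B δ σ) (hthr : 0 < thr) (hthr' : thr < c₁) (hcκ : 0 < cκ)
    (hn : horizonFactor c₁ cκ thr σ * √(m : ℝ) ≤ n) {s : ℕ} (hs : 1 ≤ s) (hsm : s ≤ m)
    (j : Fin p) :
    μ {o | (sampleSize P.numExp s * regWeight c₁ cκ thr s) ^ 2 / 16 ≤ P.exploreEnergy s j o}
      ≤ ENNReal.ofReal (Real.exp (-(tailRate c₁ cκ thr σ * (√(n : ℝ) * √(s : ℝ))))) := by
  set a : ℝ := min thr (c₁ - thr) * cκ ^ 2 / 8 with ha_def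
  have hgap : 0 < min thr (c₁ - thr) := lt_min hthr (by linarith)
  have ha : 0 < a := by positivity
  set K := horizonFactor c₁ cκ thr σ with hK_def
  have hK : 1 ≤ K := one_le_horizonFactor
  have hs' : (0 : ℝ) < s := by exact_mod_cast hs
  have hv : (0 : ℝ) < (σ : ℝ) ^ 2 + 1 := by positivity
  have hm0 : (0 : ℝ) < m := by exact_mod_cast (hs.trans hsm)
  have hn0 : (0 : ℝ) < n := lt_of_lt_of_le (by positivity) hn
  have hr : 0 < √(n : ℝ) := Real.sqrt_pos.2 hn0
  -- `horizonFactor` contains the square of this quantity for exactly this purpose.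
  have hκ : 128 * ((σ : ℝ) ^ 2 + 1) / a ^ 2 ≤ √K := by
    apply Real.le_sqrt_of_sq_le
    exact le_max_right _ _
  have hq : 0 < √√(s : ℝ) := by positivity
  have hexp := chernoff_exponent_le hv ha hκ hr hq
    (mul_sqrt_sqrt_le_sqrt (zero_le_one.trans hK) hn hsm)
    (le_sampleSize hK hn h.floor_le_numExp hsm)
  have hq2 : √√(s : ℝ) ^ 2 = √(s : ℝ) := Real.sq_sqrt (Real.sqrt_nonneg _)
  rw [hq2] at hexp
  have hreg : regWeight c₁ cκ thr s = a / √(s : ℝ) := by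
    rw [regWeight, ha_def]; field_simp
  -- The proxy is enlarged to `σ ^ 2 + 1` so that `θ` is defined also when `σ = 0`.
  have htail := measure_noiseEnergy_random_ge_le (μ := μ) (c := σ ^ 2 + 1)
    (X := fun q o => P.noise q.1 q.2 o) (Z := fun q o => P.explore q.1 q.2 o)
    (fun q => h.measurable_noise q.1 q.2) h.noise_indep
    (fun q => (h.noise_subgaussian q.1 q.2).mono_param (le_add_of_nonneg_right zero_le_one))
    (fun q => h.measurable_explore q.1 q.2) h.explore_indep (h.measurable_feature j)
    (norm_feature_le_one h.kernel_le_one j) P.numExp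
    -- The largest `θ` allowed by the bound `2 * √n` on the exploration length of a task.
    (θ := 1 / (8 * ((σ : ℝ) ^ 2 + 1) * √(n : ℝ))) (by positivity) s
    (by
      intro t ht
      have h1 := numExp_le_two_mul hK hn (ht.trans_le hsm) (h.numExp_le_ceil t (ht.trans_le hsm))
      have h2 : 1 / √√((t : ℝ) + 1) ≤ 1 := by
        rw [div_le_one (by positivity)]
        exact Real.one_le_sqrt.2 (Real.one_le_sqrt.2 (by linarith [Nat.cast_nonneg (α := ℝ) t]))
      have h3 : (P.numExp t : ℝ) ≤ 2 * √(n : ℝ) := by nlinarith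
      push_cast
      calc 4 * (1 / (8 * ((σ : ℝ) ^ 2 + 1) * √(n : ℝ))) * ((σ : ℝ) ^ 2 + 1) * P.numExp t
          ≤ 4 * (1 / (8 * ((σ : ℝ) ^ 2 + 1) * √(n : ℝ))) * ((σ : ℝ) ^ 2 + 1) * (2 * √(n : ℝ)) := by
            gcongr
        _ = 1 := by field_simp; norm_num)
    ((sampleSize P.numExp s * regWeight c₁ cκ thr s) ^ 2 / 16)
  refine htail.trans (ENNReal.ofReal_le_ofReal (Real.exp_le_exp.2 ?_))
  rw [hreg]
  push_cast
  exact hexp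

/-- The tasks before which the data may not yet identify the active kernels. -/
noncomputable def earlyTasks (c L : ℝ) (m n : ℕ) : Finset ℕ :=
  open scoped Classical in
  (Finset.range m).filter fun s => 1 ≤ s ∧ c * (√(n : ℝ) * √(s : ℝ)) < L

/-- Union bound over at most `m * p` pairs of task and kernel; the logarithmic condition makes each
of them fail with probability at most `δ / (4mp)`. -/
lemma IsLiBO.measure_exists_exploreEnergy_ge_le [IsProbabilityMeasure μ]
    (h : P.IsLiBO μ m n c₁ cκ thr B δ σ) (hthr : 0 < thr) (hthr' : thr < c₁) (hcκ : 0 < cκ)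
    (hn : horizonFactor c₁ cκ thr σ * √(m : ℝ) ≤ n) (hm : 1 ≤ m) (hp : 1 ≤ p) (hδ : 0 < δ) :
    μ {o | ∃ s, 1 ≤ s ∧ s < m ∧
        Real.log (4 * ((m : ℝ) * p / δ)) ≤ tailRate c₁ cκ thr σ * (√(n : ℝ) * √(s : ℝ)) ∧
        ∃ j, (sampleSize P.numExp s * regWeight c₁ cκ thr s) ^ 2 / 16 ≤ P.exploreEnergy s j o}
      ≤ ENNReal.ofReal (δ / 4) := by
  classical
  have hm' : (0 : ℝ) < m := by exact_mod_cast hm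
  have hp' : (0 : ℝ) < p := by exact_mod_cast hp
  set T := (Finset.range m).filter fun s : ℕ => 1 ≤ s ∧
    Real.log (4 * ((m : ℝ) * p / δ)) ≤ tailRate c₁ cκ thr σ * (√(n : ℝ) * √(s : ℝ)) with hT
  let A : ℕ × Fin p → Set Ω := fun q =>
    {o | (sampleSize P.numExp q.1 * regWeight c₁ cκ thr q.1) ^ 2 / 16 ≤ P.exploreEnergy q.1 q.2 o}
  have hsub : {o | ∃ s, 1 ≤ s ∧ s < m ∧
        Real.log (4 * ((m : ℝ) * p / δ)) ≤ tailRate c₁ cκ thr σ * (√(n : ℝ) * √(s : ℝ)) ∧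
        ∃ j, (sampleSize P.numExp s * regWeight c₁ cκ thr s) ^ 2 / 16 ≤ P.exploreEnergy s j o}
      ⊆ ⋃ q ∈ T ×ˢ (Finset.univ : Finset (Fin p)), A q := by
    rintro o ⟨s, h1, h2, h3, j, h4⟩
    refine Set.mem_biUnion (x := (s, j)) ?_ h4
    simp [hT, h1, h2, h3]
  refine (measure_mono hsub).trans ((measure_biUnion_finset_le _ _).trans ?_)
  have hq : ∀ q ∈ T ×ˢ (Finset.univ : Finset (Fin p)),
      μ (A q) ≤ ENNReal.ofReal (δ / (4 * (m * p))) := by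
    rintro ⟨s, j⟩ hq
    simp only [hT, Finset.mem_product, Finset.mem_filter, Finset.mem_range, Finset.mem_univ,
      and_true] at hq
    obtain ⟨h1, h2, h3⟩ := hq
    refine (h.measure_exploreEnergy_ge_le hthr hthr' hcκ hn h2 h1.le j).trans
      (ENNReal.ofReal_le_ofReal ?_)
    have h4 : Real.exp (-Real.log (4 * ((m : ℝ) * p / δ))) = δ / (4 * (m * p)) := by
      rw [Real.exp_neg, Real.exp_log (by positivity)]
      field_simp
    rw [← h4, Real.exp_le_exp]
    linarith
  refine (Finset.sum_le_sum hq).trans ?_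
  rw [Finset.sum_const, nsmul_eq_mul, ← ENNReal.ofReal_natCast,
    ← ENNReal.ofReal_mul (Nat.cast_nonneg _)]
  apply ENNReal.ofReal_le_ofReal
  have hcard : ((T ×ˢ (Finset.univ : Finset (Fin p))).card : ℝ) ≤ m * p := by
    rw [Finset.card_product, Finset.card_univ, Fintype.card_fin]
    have : T.card ≤ m := (Finset.card_filter_le _ _).trans (by simp)
    exact_mod_cast Nat.mul_le_mul_right p this
  calc _ ≤ (m * p : ℝ) * (δ / (4 * (m * p))) := by gcongr
    _ = δ / 4 := by field_simp

/-! ### The excess regret -/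

lemma IsLiBO.one_le_card (h : P.IsLiBO μ m n c₁ cκ thr B δ σ) : 1 ≤ p := by
  obtain ⟨j, -⟩ := h.Jstar_nonempty
  exact Nat.one_le_iff_ne_zero.2 fun h0 => by subst h0; exact j.elim0

lemma IsLiBO.abs_reward_le (h : P.IsLiBO μ m n c₁ cκ thr B δ σ) {s : ℕ} (hs : s < m) (x : 𝒳) :
    |P.reward s x| ≤ B :=
  (h.norm_le s hs).abs_le (fun x => abs_avgKernel_self_le_one h.kernel_le_one _ x) x

/-- Meta-KGL selects the active kernels if the noise energies are small and the data are
informative. -/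
lemma IsLiBO.Jhat_eq (h : P.IsLiBO μ m n c₁ cκ thr B δ σ) (hthr : 0 < thr) (hthr' : thr < c₁)
    (hcκ : 0 < cκ) (hn : horizonFactor c₁ cκ thr σ * √(m : ℝ) ≤ n) {s : ℕ} (hs : 1 ≤ s)
    (hsm : s ≤ m) {o : Ω}
    (hcomp : cκ ≤ compatibility P.φ P.numExp (fun t i => P.explore t i o) s P.Jstar.card)
    (hnoise : ∀ j, P.exploreEnergy s j o
      < (sampleSize P.numExp s * regWeight c₁ cκ thr s) ^ 2 / 16) :
    P.Jhat s o = P.Jstar := by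
  have hs' : (0 : ℝ) < s := by exact_mod_cast hs
  have hm0 : (0 : ℝ) < m := by exact_mod_cast (hs.trans hsm)
  have hK : 1 ≤ horizonFactor c₁ cκ thr σ := one_le_horizonFactor
  have hn0 : (0 : ℝ) < n := lt_of_lt_of_le (by positivity) hn
  have hN : 0 < sampleSize P.numExp s := by
    have h1 := le_sampleSize hK hn h.floor_le_numExp hsm
    have h2 : (0 : ℝ) < √(n : ℝ) * √√(s : ℝ) ^ 3 / 2 := by positivity
    exact_mod_cast h2.trans_le h1
  refine (h.metaKGL s hs hsm o).eq_of_noiseEnergy_le hthr hthr' hcκ hs hN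
    (ε := fun t i => P.noise t i o) (β := P.β) (fun t _ i => rfl)
    (fun t ht j hj => h.support t (ht.trans_le hsm) j hj) (h.betaMin s hs hsm) hcomp ?_
  intro j
  have := hnoise j
  rw [exploreEnergy] at this
  linarith

lemma IsLiBO.oracle_task_nonneg (h : P.IsLiBO μ m n c₁ cκ thr B δ σ) {s : ℕ} (hs : s < m) (o : Ω) :
    0 ≤ ∑ i ∈ Finset.Ico (P.numExp s) n,
      instRegret (P.reward s) (P.act o P.trueKernel (P.reward s) s i) :=
  Finset.sum_nonneg fun _ _ => instRegret_nonneg (h.abs_reward_le hs) _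

/-- The regret of a task in which LiBO uses the true kernel. -/
lemma IsLiBO.task_regret_le_of_kernel_eq (h : P.IsLiBO μ m n c₁ cκ thr B δ σ) {s : ℕ} (hs : s < m)
    {o : Ω} (hk : P.liboKernel o s = P.trueKernel) :
    ∑ i ∈ Finset.range n, instRegret (P.reward s) (P.act o (P.liboKernel o s) (P.reward s) s i)
      ≤ 2 * B * P.numExp s + ∑ i ∈ Finset.Ico (P.numExp s) n,
        instRegret (P.reward s) (P.act o P.trueKernel (P.reward s) s i) := by
  rw [hk]
  set g : ℕ → ℝ := fun i => instRegret (P.reward s) (P.act o P.trueKernel (P.reward s) s i)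
  have hg0 : ∀ i, 0 ≤ g i := fun i => instRegret_nonneg (h.abs_reward_le hs) _
  have hg : ∀ i, g i ≤ 2 * B := fun i => instRegret_le (h.abs_reward_le hs) _
  -- An inclusion suffices as regrets are nonnegative, and it needs no comparison of `P.numExp s`
  -- with `n`.
  have h1 : Finset.range n ⊆ Finset.range (P.numExp s) ∪ Finset.Ico (P.numExp s) n := by
    intro i hi
    simp only [Finset.mem_union, Finset.mem_range, Finset.mem_Ico] at hi ⊢
    omega
  have h2 : Disjoint (Finset.range (P.numExp s)) (Finset.Ico (P.numExp s) n) := by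
    rw [Finset.disjoint_left]
    intro i hi hi'
    simp only [Finset.mem_range, Finset.mem_Ico] at hi hi'
    omega
  calc ∑ i ∈ Finset.range n, g i
      ≤ ∑ i ∈ Finset.range (P.numExp s) ∪ Finset.Ico (P.numExp s) n, g i :=
        Finset.sum_le_sum_of_subset_of_nonneg h1 fun i _ _ => hg0 i
    _ = ∑ i ∈ Finset.range (P.numExp s), g i + ∑ i ∈ Finset.Ico (P.numExp s) n, g i :=
        Finset.sum_union h2
    _ ≤ _ := by
        gcongr
        refine (Finset.sum_le_sum fun i _ => hg i).trans (le_of_eq ?_)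
        simp [mul_comm]

lemma IsLiBO.task_regret_le (h : P.IsLiBO μ m n c₁ cκ thr B δ σ) {s : ℕ} (hs : s < m) (o : Ω) :
    ∑ i ∈ Finset.range n, instRegret (P.reward s) (P.act o (P.liboKernel o s) (P.reward s) s i)
      ≤ 2 * B * n := by
  refine (Finset.sum_le_sum fun i _ => instRegret_le (h.abs_reward_le hs) _).trans (le_of_eq ?_)
  simp [mul_comm]

/-- The regret of LiBO on the event that Meta-KGL succeeds in all late tasks. -/
lemma IsLiBO.liboRegret_le (h : P.IsLiBO μ m n c₁ cκ thr B δ σ) (hm : 1 ≤ m) (hB : 0 ≤ B)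
    {o : Ω} {c L : ℝ}
    (hk : ∀ s, 1 ≤ s → s < m → s ∉ earlyTasks c L m n → P.Jhat s o = P.Jstar) :
    P.liboRegret m n o ≤ P.oracleRegret P.reward m n o
      + 2 * B * ∑ s ∈ Finset.range m, (P.numExp s : ℝ)
      + 2 * B * n * (earlyTasks c L m n).card + 2 * B * n := by
  classical
  -- Task `0` is not counted in `earlyTasks`; its cost gets a separate summand. Early tasks may keep
  -- their oracle share because it is nonnegative.
  have htask : ∀ s ∈ Finset.range m,
      ∑ i ∈ Finset.range n, instRegret (P.reward s) (P.act o (P.liboKernel o s) (P.reward s) s i)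
      ≤ ∑ i ∈ Finset.Ico (P.numExp s) n,
          instRegret (P.reward s) (P.act o P.trueKernel (P.reward s) s i)
        + 2 * B * P.numExp s + (if s ∈ earlyTasks c L m n then 2 * B * n else 0)
        + (if s = 0 then 2 * B * n else 0) := by
    intro s hs
    have hs := Finset.mem_range.1 hs
    have h0 := h.oracle_task_nonneg hs o
    have h1 : 0 ≤ 2 * B * P.numExp s := by positivity
    have h2 : 0 ≤ 2 * B * n := by positivity
    have h3 := h.task_regret_le hs o
    by_cases hs0 : s = 0
    · rw [if_pos hs0]
      split_ifs <;> linarith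
    by_cases he : s ∈ earlyTasks c L m n
    · rw [if_pos he, if_neg hs0]
      linarith
    · rw [if_neg he, if_neg hs0]
      have hJ := hk s (Nat.one_le_iff_ne_zero.2 hs0) hs he
      have := h.task_regret_le_of_kernel_eq hs (o := o)
        (by rw [liboKernel, if_neg hs0, hJ, trueKernel])
      linarith
  refine (Finset.sum_le_sum htask).trans (le_of_eq ?_)
  rw [Finset.sum_add_distrib, Finset.sum_add_distrib, Finset.sum_add_distrib, ← Finset.mul_sum,
    oracleRegret]
  congr 2
  · rw [← Finset.sum_filter, Finset.sum_const, nsmul_eq_mul, mul_comm]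
    congr 3
    ext s
    simp only [earlyTasks, Finset.mem_filter]
    tauto
  · rw [Finset.sum_ite_eq' (Finset.range m) 0, if_pos (Finset.mem_range.2 hm)]

lemma IsLiBO.sum_numExp_le (h : P.IsLiBO μ m n c₁ cκ thr B δ σ)
    (hn : horizonFactor c₁ cκ thr σ * √(m : ℝ) ≤ n) :
    ∑ s ∈ Finset.range m, (P.numExp s : ℝ) ≤ 4 * ((m : ℝ) ^ (3 / 4 : ℝ) * √(n : ℝ)) := by
  have h1 : ∀ s ∈ Finset.range m,
      (P.numExp s : ℝ) ≤ 2 * √(n : ℝ) * (1 / √√((s : ℝ) + 1)) := by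
    intro s hs
    have hs := Finset.mem_range.1 hs
    have := numExp_le_two_mul one_le_horizonFactor hn hs (h.numExp_le_ceil s hs)
    linarith
  refine (Finset.sum_le_sum h1).trans ?_
  rw [← Finset.mul_sum, rpow_three_quarters_eq_sqrt_sqrt (by positivity)]
  have := mul_le_mul_of_nonneg_left (sum_inv_sqrt_sqrt_le m)
    (by positivity : 0 ≤ 2 * √(n : ℝ))
  linarith

/-- The early tasks contribute little to the regret. -/
lemma mul_card_earlyTasks_le {c : ℝ} (hc : 0 < c) (hn : 1 ≤ n) (hp : 1 ≤ p) (hδ : 0 < δ)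
    (hδ' : δ < 1) :
    n * ((earlyTasks c (Real.log (4 * ((m : ℝ) * p / δ))) m n).card : ℝ)
      ≤ (9 / c ^ 2) ^ (2 / 3 : ℝ) *
        (((n : ℝ) * m) ^ (1 / 3 : ℝ) * Real.log ((m : ℝ) * p / δ) ^ (4 / 3 : ℝ)) := by
  have hp' : (1 : ℝ) ≤ p := by exact_mod_cast hp
  have hn' : (1 : ℝ) ≤ n := by exact_mod_cast hn
  -- For `m < 2` there are no early tasks; otherwise `mp/δ ≥ 2`, which allows `log (4x) ≤ 3 log x`.
  rcases Nat.lt_or_ge m 2 with hm | hm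
  · have hempty : earlyTasks c (Real.log (4 * ((m : ℝ) * p / δ))) m n = ∅ := by
      rw [earlyTasks, Finset.filter_eq_empty_iff]
      intro s hs
      have := Finset.mem_range.1 hs
      omega
    rw [hempty, Finset.card_empty, Nat.cast_zero, mul_zero]
    rcases Nat.eq_zero_or_pos m with rfl | hm0
    · simp
    have hm' : (1 : ℝ) ≤ m := by exact_mod_cast hm0
    have : 0 ≤ Real.log ((m : ℝ) * p / δ) := by
      apply Real.log_nonneg
      rw [le_div_iff₀ hδ]
      nlinarith
    positivity
  have hm' : (2 : ℝ) ≤ m := by exact_mod_cast hm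
  set L₀ := Real.log ((m : ℝ) * p / δ) with hL₀
  have harg : 2 ≤ (m : ℝ) * p / δ := by
    rw [le_div_iff₀ hδ]
    nlinarith
  have hlog2 : Real.log 2 ≤ L₀ := Real.log_le_log (by norm_num) harg
  have hL0 : 0 < L₀ := lt_of_lt_of_le (Real.log_pos (by norm_num)) hlog2
  have hL : Real.log (4 * ((m : ℝ) * p / δ)) ≤ 3 * L₀ := by
    rw [Real.log_mul (by norm_num) (by linarith), show (4 : ℝ) = 2 ^ 2 by norm_num, Real.log_pow]
    push_cast
    linarith
  set L := Real.log (4 * ((m : ℝ) * p / δ))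
  set k : ℝ := ((earlyTasks c L m n).card : ℝ) with hk
  have hk0 : 0 ≤ k := Nat.cast_nonneg _
  have hkm : k ≤ m := by
    have : (earlyTasks c L m n).card ≤ m := (Finset.card_filter_le _ _).trans (by simp)
    exact Nat.cast_le.2 this
  have hkL : n * k ≤ 9 / c ^ 2 * L₀ ^ 2 := by
    have hsub : earlyTasks c L m n ⊆ Finset.Icc 1 ⌊9 * L₀ ^ 2 / (c ^ 2 * n)⌋₊ := by
      intro s hs
      rw [earlyTasks, Finset.mem_filter] at hs
      obtain ⟨-, h1, h2⟩ := hs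
      rw [Finset.mem_Icc]
      refine ⟨h1, Nat.le_floor ?_⟩
      rw [le_div_iff₀ (by positivity)]
      have h3 : c * (√(n : ℝ) * √(s : ℝ)) ≤ 3 * L₀ := h2.le.trans hL
      have h4 := pow_le_pow_left₀ (by positivity) h3 2
      rw [mul_pow, mul_pow, Real.sq_sqrt (by positivity), Real.sq_sqrt (by positivity)] at h4
      nlinarith
    have h1 := Finset.card_le_card hsub
    rw [Nat.card_Icc, Nat.add_sub_cancel] at h1
    have h2 : k ≤ 9 * L₀ ^ 2 / (c ^ 2 * n) :=
      (Nat.cast_le.2 h1).trans (Nat.floor_le (by positivity))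
    rw [le_div_iff₀ (by positivity)] at h2
    rw [div_mul_eq_mul_div, le_div_iff₀ (by positivity)]
    linarith
  have hw : 0 ≤ n * k := by positivity
  -- Interpolation: the first factor uses `k ≤ m`, the second the logarithmic bound `hkL`.
  have hsplit : n * k = (n * k) ^ (1 / 3 : ℝ) * (n * k) ^ (2 / 3 : ℝ) := by
    rw [← Real.rpow_add_of_nonneg hw (by norm_num) (by norm_num)]
    norm_num
  rw [hsplit]
  have hpow : (9 / c ^ 2 * L₀ ^ 2) ^ (2 / 3 : ℝ) = (9 / c ^ 2) ^ (2 / 3 : ℝ) * L₀ ^ (4 / 3 : ℝ) := by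
    rw [Real.mul_rpow (by positivity) (by positivity), ← Real.rpow_natCast L₀ 2,
      ← Real.rpow_mul hL0.le]
    norm_num
  calc (n * k) ^ (1 / 3 : ℝ) * (n * k) ^ (2 / 3 : ℝ)
      ≤ ((n : ℝ) * m) ^ (1 / 3 : ℝ) * (9 / c ^ 2 * L₀ ^ 2) ^ (2 / 3 : ℝ) :=
        mul_le_mul (Real.rpow_le_rpow hw (mul_le_mul_of_nonneg_left hkm (by positivity))
          (by norm_num)) (Real.rpow_le_rpow hw hkL (by norm_num)) (Real.rpow_nonneg hw _)
          (Real.rpow_nonneg (by positivity) _)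
    _ = _ := by rw [hpow]; ring

/-- The constant in the bound on the excess regret. -/
noncomputable def excessFactor (c₁ cκ thr : ℝ) (σ : ℝ≥0) : ℝ :=
  10 + 2 * (9 / tailRate c₁ cκ thr σ ^ 2) ^ (2 / 3 : ℝ)

lemma ten_le_excessFactor : 10 ≤ excessFactor c₁ cκ thr σ := by
  unfold excessFactor
  have : 0 ≤ (9 / tailRate c₁ cκ thr σ ^ 2) ^ (2 / 3 : ℝ) := by positivity
  linarith

/-- The excess regret of LiBO, with the contribution of the first task kept apart. -/
theorem IsLiBO.measure_liboRegret_gt_le [IsProbabilityMeasure μ]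
    (h : P.IsLiBO μ m n c₁ cκ thr B δ σ) (hthr : 0 < thr) (hthr' : thr < c₁) (hcκ : 0 < cκ)
    (hm : 1 ≤ m) (hn : horizonFactor c₁ cκ thr σ * √(m : ℝ) ≤ n) (hB : 0 < B) (hδ : 0 < δ)
    (hδ' : δ < 1) {Rstar : ℝ} (hR : P.HasOracleRegret μ m n B (δ / 2) Rstar) {W : ℝ}
    (hW : excessFactor c₁ cκ thr σ * excessRate B δ p m n
      - 2 * (B * (m : ℝ) ^ (3 / 4 : ℝ) * √(n : ℝ)) + 2 * B * n ≤ W) :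
    μ {o | Rstar + W < P.liboRegret m n o} ≤ ENNReal.ofReal δ := by
  have hp : 1 ≤ p := h.one_le_card
  have hm' : (1 : ℝ) ≤ m := by exact_mod_cast hm
  have hp' : (1 : ℝ) ≤ p := by exact_mod_cast hp
  have hn1 : 1 ≤ n := by
    have h1 : (0 : ℝ) < horizonFactor c₁ cκ thr σ * √(m : ℝ) :=
      mul_pos (zero_lt_one.trans_le one_le_horizonFactor) (by positivity)
    have : (0 : ℝ) < n := h1.trans_le hn
    exact_mod_cast this
  set c := tailRate c₁ cκ thr σ with hc
  have hc0 : 0 < c := tailRate_pos hthr hthr' hcκ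
  set L := Real.log (4 * ((m : ℝ) * p / δ)) with hL
  -- The budget `δ` is split into `δ/4` for uninformative data, `δ/4` for strong noise and `δ/2` for
  -- the oracle.
  let E₁ : Set Ω := {o | ∃ s, 1 ≤ s ∧ s ≤ m ∧
      compatibility P.φ P.numExp (fun t i => P.explore t i o) s P.Jstar.card < cκ}
  let E₂ : Set Ω := {o | ∃ s, 1 ≤ s ∧ s < m ∧ L ≤ c * (√(n : ℝ) * √(s : ℝ)) ∧
        ∃ j, (sampleSize P.numExp s * regWeight c₁ cκ thr s) ^ 2 / 16 ≤ P.exploreEnergy s j o}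
  let E₃ : Set Ω := {o | Rstar < P.oracleRegret P.reward m n o}
  have hsub : {o | Rstar + W < P.liboRegret m n o} ⊆ E₁ ∪ E₂ ∪ E₃ := by
    intro o ho
    by_contra hcon
    simp only [E₁, E₂, E₃, Set.mem_union, Set.mem_ofPred_eq, not_or, not_exists, not_and,
      not_lt, not_le] at hcon
    obtain ⟨⟨g1, g2⟩, g3⟩ := hcon
    have hk : ∀ s, 1 ≤ s → s < m → s ∉ earlyTasks c L m n → P.Jhat s o = P.Jstar := by
      intro s hs hsm he
      refine h.Jhat_eq hthr hthr' hcκ hn hs hsm.le (g1 s hs hsm.le) fun j => ?_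
      refine g2 s hs hsm ?_ j
      by_contra hlt
      refine he (Finset.mem_filter.2 ⟨Finset.mem_range.2 hsm, hs, not_le.1 hlt⟩)
    have h1 := h.liboRegret_le hm hB.le hk
    -- Exploration uses 8 of the constant 10 in `excessFactor`; the remaining 2 is what `hW`
    -- subtracts, kept for the first task.
    have h2 := mul_le_mul_of_nonneg_left (h.sum_numExp_le hn) (by positivity : 0 ≤ 2 * B)
    have h3 := mul_le_mul_of_nonneg_left
      (mul_card_earlyTasks_le (m := m) hc0 hn1 hp hδ hδ') (by positivity : 0 ≤ 2 * B)
    rw [Set.mem_ofPred_eq] at ho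
    have hlog : 0 ≤ Real.log ((m : ℝ) * p / δ) := by
      apply Real.log_nonneg
      rw [le_div_iff₀ hδ]
      nlinarith
    unfold excessFactor excessRate at hW
    rw [← hc] at hW
    set D := (9 / c ^ 2) ^ (2 / 3 : ℝ)
    set a := (m : ℝ) ^ (3 / 4 : ℝ)
    set b := ((n : ℝ) * m) ^ (1 / 3 : ℝ)
    set l := Real.log ((m : ℝ) * p / δ) ^ (4 / 3 : ℝ)
    have hD : 0 ≤ D := by positivity
    have q1 : 0 ≤ D * (B * a * √(n : ℝ)) := by positivity
    have q2 : 0 ≤ B * b * l := by positivity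
    linarith
  refine (measure_mono hsub).trans ?_
  have hE₁ : μ E₁ ≤ ENNReal.ofReal (δ / 4) := h.informative
  have hE₂ : μ E₂ ≤ ENNReal.ofReal (δ / 4) :=
    h.measure_exists_exploreEnergy_ge_le hthr hthr' hcκ hn hm hp hδ
  have hE₃ : μ E₃ ≤ ENNReal.ofReal (δ / 2) := hR P.reward h.norm_le
  calc μ (E₁ ∪ E₂ ∪ E₃) ≤ μ (E₁ ∪ E₂) + μ E₃ := measure_union_le _ _
    _ ≤ μ E₁ + μ E₂ + μ E₃ := by gcongr; exact measure_union_le _ _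
    _ ≤ ENNReal.ofReal (δ / 4) + ENNReal.ofReal (δ / 4) + ENNReal.ofReal (δ / 2) := by gcongr
    _ = ENNReal.ofReal δ := by
      rw [← ENNReal.ofReal_add (by positivity) (by positivity),
        ← ENNReal.ofReal_add (by positivity) (by positivity)]
      congr 1
      ring

end LifelongBandit


/-! ### The excess rate is sublinear -/

section Asymptotics

open Filter Topology

lemma tendsto_excess_coefficient {k : ℝ} (hk : 0 < k) (a : ℝ) :
    Tendsto (fun m : ℕ => a * ((m : ℝ) ^ (-(1 / 4) : ℝ) +
      (m : ℝ) ^ (-(2 / 3) : ℝ) * Real.log ((m : ℝ) * k) ^ (4 / 3 : ℝ))) atTop (𝓝 0) := by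
  have h1 : Tendsto (fun m : ℕ => (m : ℝ) ^ (-(1 / 4) : ℝ)) atTop (𝓝 0) :=
    (tendsto_rpow_neg_atTop (by norm_num)).comp tendsto_natCast_atTop_atTop
  have hx : Tendsto (fun m : ℕ => (m : ℝ) * k) atTop atTop :=
    tendsto_natCast_atTop_atTop.atTop_mul_const hk
  have h2 := ((isLittleO_log_rpow_rpow_atTop (4 / 3 : ℝ)
    (by norm_num : (0 : ℝ) < 2 / 3)).tendsto_div_nhds_zero.comp hx).const_mul (k ^ (2 / 3 : ℝ))
  have h3 : Tendsto (fun m : ℕ => (m : ℝ) ^ (-(2 / 3) : ℝ) *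
      Real.log ((m : ℝ) * k) ^ (4 / 3 : ℝ)) atTop (𝓝 0) := by
    rw [mul_zero] at h2
    refine h2.congr fun m => ?_
    rw [Function.comp_apply, Real.mul_rpow (Nat.cast_nonneg m) hk.le,
      Real.rpow_neg (Nat.cast_nonneg m)]
    have : k ^ (2 / 3 : ℝ) ≠ 0 := (Real.rpow_pos_of_pos hk _).ne'
    field_simp
  simpa using (h1.add h3).const_mul a

/-- The factor in front of `m * √n` is free of `n`, because `n^{1/3} ≤ √n`; so one `M` can serve all
horizons. -/
lemma excessRate_le {B δ : ℝ} {p m n : ℕ} (hB : 0 ≤ B) (hδ : 0 < δ) (hδ' : δ ≤ 1) (hp : 1 ≤ p)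
    (hm : 1 ≤ m) (hn : 1 ≤ n) :
    excessRate B δ p m n ≤ B * ((m : ℝ) ^ (-(1 / 4) : ℝ) +
      (m : ℝ) ^ (-(2 / 3) : ℝ) * Real.log ((m : ℝ) * (p / δ)) ^ (4 / 3 : ℝ)) *
      (m * √(n : ℝ)) := by
  have hm' : (1 : ℝ) ≤ m := by exact_mod_cast hm
  have hp' : (1 : ℝ) ≤ p := by exact_mod_cast hp
  have hn' : (1 : ℝ) ≤ n := by exact_mod_cast hn
  have hm0 : (0 : ℝ) < m := by linarith
  have hlog : 0 ≤ Real.log ((m : ℝ) * (p / δ)) := by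
    apply Real.log_nonneg
    rw [← mul_div_assoc, le_div_iff₀ hδ]
    nlinarith
  have h1 : (m : ℝ) ^ (3 / 4 : ℝ) = (m : ℝ) ^ (-(1 / 4) : ℝ) * m := by
    rw [← Real.rpow_add_one hm0.ne']
    norm_num
  have h2 : (m : ℝ) ^ (1 / 3 : ℝ) = (m : ℝ) ^ (-(2 / 3) : ℝ) * m := by
    rw [← Real.rpow_add_one hm0.ne']
    norm_num
  have h3 : (n : ℝ) ^ (1 / 3 : ℝ) ≤ √(n : ℝ) := by
    rw [Real.sqrt_eq_rpow]
    exact Real.rpow_le_rpow_of_exponent_le hn' (by norm_num)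
  rw [excessRate, Real.mul_rpow (by positivity) (by positivity), mul_div_assoc, h1, h2]
  set l := Real.log ((m : ℝ) * (p / δ)) ^ (4 / 3 : ℝ)
  have hl : 0 ≤ B * ((m : ℝ) ^ (-(2 / 3) : ℝ) * m) * l := by positivity
  have h4 := mul_le_mul_of_nonneg_left h3 hl
  linarith

lemma le_rpow_mul_sqrt {m n : ℕ} (hmn : (n : ℝ) ≤ (m : ℝ) ^ (3 / 2 : ℝ)) :
    (n : ℝ) ≤ (m : ℝ) ^ (3 / 4 : ℝ) * √(n : ℝ) := by
  have h1 : √(n : ℝ) ≤ (m : ℝ) ^ (3 / 4 : ℝ) := by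
    apply Real.sqrt_le_iff.2 ⟨by positivity, ?_⟩
    rw [← Real.rpow_natCast, ← Real.rpow_mul (Nat.cast_nonneg m)]
    norm_num at hmn ⊢
    exact hmn
  calc (n : ℝ) = √(n : ℝ) * √(n : ℝ) := (Real.mul_self_sqrt (Nat.cast_nonneg n)).symm
    _ ≤ _ := by gcongr

end Asymptotics

end LiBO

/-! ### Regret bounds and oracle optimality -/

theorem mainTheorem1 (c₁ cκ thr : ℝ) (σ : ℝ≥0) (hthr : 0 < thr) (hthr' : thr < c₁)
    (hcκ : 0 < cκ) :
    ∃ C K : ℝ, 0 < C ∧ 0 < K ∧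
      (∀ (𝒳 : Type u) (Ω : Type v) (𝒰 : Type w) [MeasurableSpace 𝒳] [MeasurableSpace Ω]
        (μ : Measure Ω) [IsProbabilityMeasure μ] (p m n : ℕ) (B δ Rstar : ℝ)
        (P : LiBO.LifelongBandit 𝒳 Ω 𝒰 p),
        1 ≤ m → K * √(m : ℝ) ≤ n → 0 < B → 0 < δ → δ < 1 →
        P.IsLiBO μ m n c₁ cκ thr B δ σ → P.HasOracleRegret μ m n B (δ / 2) Rstar →
        μ {o | Rstar + C * LiBO.excessRate B δ p m n + 2 * B * n < P.liboRegret m n o}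
            ≤ ENNReal.ofReal δ ∧
          ((n : ℝ) ≤ (m : ℝ) ^ (3 / 2 : ℝ) →
            μ {o | Rstar + C * LiBO.excessRate B δ p m n < P.liboRegret m n o}
              ≤ ENNReal.ofReal δ)) ∧
      (∀ (p : ℕ) (B δ η : ℝ), 0 < B → 0 < δ → δ < 1 → 0 < η → ∃ M : ℕ,
        ∀ (𝒳 : Type u) (Ω : Type v) (𝒰 : Type w) [MeasurableSpace 𝒳] [MeasurableSpace Ω]
        (μ : Measure Ω) [IsProbabilityMeasure μ] (m n : ℕ) (Rstar : ℝ)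
        (P : LiBO.LifelongBandit 𝒳 Ω 𝒰 p),
        M ≤ m → 1 ≤ m → K * √(m : ℝ) ≤ n →
        P.IsLiBO μ m n c₁ cκ thr B δ σ → P.HasOracleRegret μ m n B (δ / 2) Rstar →
        μ {o | Rstar + η * ((m : ℝ) * n) < P.liboRegret m n o} ≤ ENNReal.ofReal δ ∧
          ((n : ℝ) ≤ (m : ℝ) ^ (3 / 2 : ℝ) →
            μ {o | Rstar + η * ((m : ℝ) * √(n : ℝ)) < P.liboRegret m n o}
              ≤ ENNReal.ofReal δ)) := by
  have hC := LiBO.LifelongBandit.ten_le_excessFactor (c₁ := c₁) (cκ := cκ) (thr := thr) (σ := σ)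
  have hK := LiBO.LifelongBandit.one_le_horizonFactor (c₁ := c₁) (cκ := cκ) (thr := thr) (σ := σ)
  set C := LiBO.LifelongBandit.excessFactor c₁ cκ thr σ with hC_def
  set K := LiBO.LifelongBandit.horizonFactor c₁ cκ thr σ with hK_def
  refine ⟨C, K, by linarith, by linarith, ?_, ?_⟩
  · intro 𝒳 Ω 𝒰 _ _ μ _ p m n B δ Rstar P hm hn hB hδ hδ' h hR
    have h0 : 0 ≤ B * (m : ℝ) ^ (3 / 4 : ℝ) * √(n : ℝ) := by positivity
    constructor
    · simp_rw [add_assoc Rstar]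
      exact h.measure_liboRegret_gt_le hthr hthr' hcκ hm hn hB hδ hδ' hR (by linarith)
    · intro hmn
      -- For `n ≤ m^{3/2}` the cost `2 * B * n` of the first task fits into the reserved `2 * (B *
      -- m^{3/4} * √n)`.
      have h1 := mul_le_mul_of_nonneg_left (LiBO.le_rpow_mul_sqrt hmn) hB.le
      exact h.measure_liboRegret_gt_le hthr hthr' hcκ hm hn hB hδ hδ' hR (by linarith)
  · intro p B δ η hB hδ hδ' hη
    rcases Nat.eq_zero_or_pos p with rfl | hp
    · exact ⟨0, fun 𝒳 Ω 𝒰 _ _ μ _ m n Rstar P _ _ _ h _ => absurd h.one_le_card (by norm_num)⟩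
    have hp' : (0 : ℝ) < p := by exact_mod_cast hp
    -- The second summand is the share of the first task: `2 * B * n = (2 * B / m) * (m * n)`.
    have hlim := (LiBO.tendsto_excess_coefficient (div_pos hp' hδ) (C * B)).add
      (tendsto_const_div_atTop_nhds_zero_nat (2 * B))
    rw [add_zero] at hlim
    obtain ⟨M, hM⟩ := Filter.eventually_atTop.1 (hlim.eventually_lt_const hη)
    refine ⟨M, fun 𝒳 Ω 𝒰 _ _ μ _ m n Rstar P hMm hm hn h hR => ?_⟩
    have hm' : (1 : ℝ) ≤ m := by exact_mod_cast hm
    have hn0 : (0 : ℝ) < n := lt_of_lt_of_le (by positivity) hn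
    have hn1 : 1 ≤ n := by exact_mod_cast hn0
    have hn' : (1 : ℝ) ≤ n := by exact_mod_cast hn1
    have hη' := hM m hMm
    have hrate := mul_le_mul_of_nonneg_left
      (LiBO.excessRate_le hB.le hδ hδ'.le hp hm hn1) (by linarith : 0 ≤ C)
    have h0 : 0 ≤ B * (m : ℝ) ^ (3 / 4 : ℝ) * √(n : ℝ) := by positivity
    have hlog : 0 ≤ Real.log ((m : ℝ) * (p / δ)) := by
      apply Real.log_nonneg
      rw [← mul_div_assoc, le_div_iff₀ hδ]
      have : (1 : ℝ) ≤ p := by exact_mod_cast hp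
      nlinarith
    set A := (m : ℝ) ^ (-(1 / 4) : ℝ) +
      (m : ℝ) ^ (-(2 / 3) : ℝ) * Real.log ((m : ℝ) * (p / δ)) ^ (4 / 3 : ℝ)
    have hA : 0 ≤ C * B * A := by positivity
    have h2B : 0 ≤ 2 * B / (m : ℝ) := by positivity
    have hsqrt : √(n : ℝ) ≤ n := Real.sqrt_le_self_iff.2 (Or.inr hn')
    constructor
    · refine h.measure_liboRegret_gt_le hthr hthr' hcκ hm hn hB hδ hδ' hR ?_
      have h1 : C * B * A * (m * √(n : ℝ)) ≤ C * B * A * (m * n) := by gcongr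
      have h2 : 2 * B * n = 2 * B / m * (m * n) := by field_simp
      have h3 : (C * B * A + 2 * B / m) * (m * n) ≤ η * (m * n) := by gcongr
      linarith
    · intro hmn
      refine h.measure_liboRegret_gt_le hthr hthr' hcκ hm hn hB hδ hδ' hR ?_
      have h1 := mul_le_mul_of_nonneg_left (LiBO.le_rpow_mul_sqrt hmn) hB.le
      have h3 : C * B * A * (m * √(n : ℝ)) ≤ η * (m * √(n : ℝ)) := by
        gcongr
        linarith
      linarith
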